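/- Let $G$ be a group with neutral element $\varepsilon$ and let $R=\bigoplus_{g\in G}R_g$ be a $G$-graded associative ring with unit (the $R_g$ are additive subgroups with $R_gR_h\subseteq R_{gh}$ for all $g,h\in G$). A graded left $R$-module is a left $R$-module $M$ with a decomposition $M=\bigoplus_{g\in G}M_g$ into additive subgroups such that $R_gM_h\subseteq M_{gh}$; a morphism of graded modules $f:M\to N$ is an $R$-linear map with $f(M_g)\subseteq N_g$ for all $g\in G$. A left (right) ideal of $R$ is graded if it contains the homogeneous components of each of its elements. $R$ is graded left (right) Noetherian, respectively Artinian, if its graded left (right) ideals satisfy the ascending, respectively descending, chain condition, and graded Artinian if it is both graded left Artinian and graded right Artinian. For $S\subseteq R$ put $\mathrm{ann}_\ell(S)=\{r\in R : rs=0 \text{ for all } s\in S\}$ and $\mathrm{ann}_r(S)=\{r\in R : sr=0\text{ for all } s\in S\}$. $R$ is graded left injective (graded left self-injective) if $R$, as a graded left $R$-module, is an injective object of the category of graded left $R$-modules. The following assertions are equivalent. 1. $R$ is graded Artinian, $\mathrm{ann}_r(\mathrm{ann}_\ell(A))=A$ for every graded right ideal $A$ of $R$, and $\mathrm{ann}_\ell(\mathrm{ann}_r(U))=U$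 for every graded left ideal $U$ of $R$. 2. $R$ is graded left Noetherian, $\mathrm{ann}_r(\mathrm{ann}_\ell(A))=A$ for every graded right ideal $A$ of $R$, and $\mathrm{ann}_\ell(\mathrm{ann}_r(U))=U$ for every graded left ideal $U$ of $R$. 3. $R$ is graded left Noetherian and graded left injective. 4. $R$ is graded right Noetherian and graded left injective. -/

import Mathlib

universe u v

namespace GradedQF

section Modules

variable {G : Type v} [AddGroup G] [DecidableEq G] {R : Type u} [Ring R]

/-- An `R`-linear map between modules with families of components `ℳ` and `𝒩` is a morphism of
graded modules if it maps `M_g` into `N_g` for every `g`. -/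
def IsGradedHom {M N : Type*} [AddCommGroup M] [Module R M] [AddCommGroup N] [Module R N]
    (ℳ : G → AddSubgroup M) (𝒩 : G → AddSubgroup N) (f : M →ₗ[R] N) : Prop :=
  ∀ g : G, ∀ x ∈ ℳ g, f x ∈ 𝒩 g

/-- A graded left module `E = ⨁ E_g` over the `G`-graded ring `R = ⨁ R_g` is graded injective if
it is an injective object of the category of graded left `R`-modules and morphisms of degree zero:
for every injective morphism `i : M → N` of graded left modules, every morphism `f : M → E` of
graded left modules extends along `i` to a morphism `h : N → E` of graded left modules.

A graded left module is a left module `M` with a decomposition `M = ⨁ M_g` into additive subgroups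
(`DirectSum.Decomposition ℳ`) such that `R_g M_h ⊆ M_{g+h}` (`SetLike.GradedSMul 𝒜 ℳ`). -/
def IsGradedInjective (𝒜 : G → AddSubgroup R) [GradedRing 𝒜]
    {E : Type u} [AddCommGroup E] [Module R E] (ℰ : G → AddSubgroup E) : Prop :=
  ∀ (M N : Type u) [AddCommGroup M] [Module R M] [AddCommGroup N] [Module R N]
    (ℳ : G → AddSubgroup M) (𝒩 : G → AddSubgroup N)
    [DirectSum.Decomposition ℳ] [SetLike.GradedSMul 𝒜 ℳ]
    [DirectSum.Decomposition 𝒩] [SetLike.GradedSMul 𝒜 𝒩]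
    (i : M →ₗ[R] N) (f : M →ₗ[R] E),
    IsGradedHom ℳ 𝒩 i → Function.Injective i → IsGradedHom ℳ ℰ f →
      ∃ h : N →ₗ[R] E, IsGradedHom 𝒩 ℰ h ∧ ∀ x : M, h (i x) = f x

end Modules

section Rings

variable {R : Type u} [Ring R]

/-- The left annihilator `{r | r s = 0 for all s ∈ S}`, a left ideal. -/
def leftAnn (S : Set R) : Submodule R R where
  carrier := {r | ∀ s ∈ S, r * s = 0}
  add_mem' ha hb s hs := by rw [add_mul, ha s hs, hb s hs, add_zero]
  zero_mem' s _ := zero_mul s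
  smul_mem' c r hr s hs := by rw [smul_eq_mul, mul_assoc, hr s hs, mul_zero]

/-- The right annihilator `{r | s r = 0 for all s ∈ S}`, a right ideal. -/
def rightAnn (S : Set R) : Submodule Rᵐᵒᵖ R where
  carrier := {r | ∀ s ∈ S, s * r = 0}
  add_mem' ha hb s hs := by rw [mul_add, ha s hs, hb s hs, add_zero]
  zero_mem' s _ := mul_zero s
  smul_mem' c r hr s hs := by
    rw [MulOpposite.smul_eq_mul_unop, ← mul_assoc, hr s hs, zero_mul]

variable {G : Type v} [AddGroup G] [DecidableEq G] (𝒜 : G → AddSubgroup R) [GradedRing 𝒜]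

/-- Graded left ideals: left ideals containing the homogeneous components of their elements. -/
abbrev GradedLeftIdeal : Type u := {U : Submodule R R // U.IsHomogeneous 𝒜}

/-- Graded right ideals: right ideals containing the homogeneous components of their elements. -/
abbrev GradedRightIdeal : Type u := {A : Submodule Rᵐᵒᵖ R // A.IsHomogeneous 𝒜}

/-- Ascending chain condition on graded left ideals. -/
def IsGradedLeftNoetherian : Prop := WellFoundedGT (GradedLeftIdeal 𝒜)

/-- Ascending chain condition on graded right ideals. -/
def IsGradedRightNoetherian : Prop := WellFoundedGT (GradedRightIdeal 𝒜)

/-- Descending chain condition on graded left ideals. -/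
def IsGradedLeftArtinian : Prop := WellFoundedLT (GradedLeftIdeal 𝒜)

/-- Descending chain condition on graded right ideals. -/
def IsGradedRightArtinian : Prop := WellFoundedLT (GradedRightIdeal 𝒜)

/-- Graded Artinian means graded left Artinian and graded right Artinian. -/
def IsGradedArtinian : Prop := IsGradedLeftArtinian 𝒜 ∧ IsGradedRightArtinian 𝒜

/-- `ann_r (ann_l A) = A` for every graded right ideal `A`. -/
def RightDoubleAnnihilator : Prop :=
  ∀ A : Submodule Rᵐᵒᵖ R, A.IsHomogeneous 𝒜 → rightAnn (leftAnn (A : Set R) : Set R) = A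

/-- `ann_l (ann_r U) = U` for every graded left ideal `U`. -/
def LeftDoubleAnnihilator : Prop :=
  ∀ U : Submodule R R, U.IsHomogeneous 𝒜 → leftAnn (rightAnn (U : Set R) : Set R) = U

/-- `R` is graded left (self-)injective: graded injective as a graded left module over itself. -/
def IsGradedLeftSelfInjective : Prop := IsGradedInjective 𝒜 𝒜

end Rings

end GradedQF

/-!
The implications are proved in the cycle (1) ⇒ (2) ⇒ (3) ⇒ (4) ⇒ (1).

The double annihilator conditions make `ann_l` and `ann_r` inverse anti-isomorphisms between the
graded left and the graded right ideals, which gives (1) ⇒ (2). For (2) ⇒ (3) they also give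
`ann_r (U ∩ V) = ann_r U + ann_r V`; so maps from finitely generated graded left ideals to `R` are
right multiplications, and Baer's criterion applies. Partially defined graded linear maps of any
degree are handled through their graphs, here and wherever self-injectivity is used
(`IsGradedLeftSelfInjective.exists_right_multiplier`).

For (3) ⇒ (4), self-injectivity turns maximal left annihilators of homogeneous elements into minimal
principal right ideals. A Noetherian induction on graded two-sided ideals then shows that `R` is
graded left Artinian (`IsGradedLeftNoetherian.isGradedLeftArtinian`): a nilpotent ideal can be split
off, and in a semiprime quotient a minimal right ideal produces a minimal left ideal. Left
annihilators now detect all graded right ideals, and `R` is graded right Noetherian.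

In (4) ⇒ (1) the right double annihilator condition comes from the Noetherian hypothesis, and makes
the graded two-sided ideals satisfy both chain conditions. The ring is von Neumann regular modulo
its graded singular ideal, which by Nakayama's lemma lies in every graded prime `P`
(`IsGradedPrime.singularIdeal_le`). Hence graded primes are maximal, finite in number, and each
`R / P` has a minimal left ideal. For each `P` there is a homogeneous `y ≠ 0` with `y P = 0` and
with the left annihilator of `R y` prime; this defines an injective, hence surjective, self-map of
the finite set of primes. So every graded simple left module embeds into `R`
(`IsGradedLeftSelfInjective.exists_annihilated_by_maximal`), which yields the left double
annihilator condition and the left Artinian property. The right Artinian property follows by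
applying the Noetherian induction to the opposite ring.
-/

namespace GradedQF

open DirectSum

/-! ### Homogeneous components -/

section Components

variable {G : Type v} [DecidableEq G] {M : Type*} [AddCommGroup M]
  (ℳ : G → AddSubgroup M) [Decomposition ℳ]

/-- The homogeneous component of degree `g`, as an additive endomorphism. -/
def component (g : G) : M →+ M :=
  (ℳ g).subtype.comp ((DFinsupp.evalAddMonoidHom g).comp (decomposeAddEquiv ℳ).toAddMonoidHom)

theorem component_mem (g : G) (x : M) : component ℳ g x ∈ ℳ g := (decompose ℳ x g).2

theorem component_of_mem {g : G} {x : M} (hx : x ∈ ℳ g) : component ℳ g x = x :=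
  decompose_of_mem_same ℳ hx

theorem component_of_mem_ne {g k : G} {x : M} (hx : x ∈ ℳ g) (h : g ≠ k) :
    component ℳ k x = 0 :=
  decompose_of_mem_ne ℳ hx h

theorem exists_sum_component (x : M) : ∃ s : Finset G, ∑ g ∈ s, component ℳ g x = x := by
  classical exact ⟨_, sum_support_decompose ℳ x⟩

theorem mem_of_component_mem {S : Type*} [SetLike S M] [AddSubmonoidClass S M] (U : S) {x : M}
    (h : ∀ g, component ℳ g x ∈ U) : x ∈ U := by
  obtain ⟨s, hs⟩ := exists_sum_component ℳ x
  rw [← hs]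
  exact sum_mem fun g _ => h g

theorem eq_zero_of_component {x : M} (h : ∀ g, component ℳ g x = 0) : x = 0 := by
  have : x ∈ (⊥ : AddSubgroup M) := mem_of_component_mem ℳ _ fun g => by simp [h g]
  simpa using this

variable {ℳ}

theorem le_of_homogeneous_mem {S : Type*} [Semiring S] [Module S M] {U V : Submodule S M}
    (hU : U.IsHomogeneous ℳ) (h : ∀ g, ∀ x ∈ ℳ g, x ∈ U → x ∈ V) : U ≤ V := fun _ hx =>
  mem_of_component_mem ℳ V fun g => h g _ (component_mem ℳ g _) (hU g hx)

theorem isHomogeneous_sup {S : Type*} [Semiring S] [Module S M] {U V : Submodule S M}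
    (hU : U.IsHomogeneous ℳ) (hV : V.IsHomogeneous ℳ) : (U ⊔ V).IsHomogeneous ℳ := by
  intro g x hx
  obtain ⟨u, hu, v, hv, rfl⟩ := Submodule.mem_sup.1 hx
  change component ℳ g (u + v) ∈ _
  rw [map_add]
  exact Submodule.add_mem_sup (hU g hu) (hV g hv)

theorem isHomogeneous_inf {S : Type*} [Semiring S] [Module S M] {U V : Submodule S M}
    (hU : U.IsHomogeneous ℳ) (hV : V.IsHomogeneous ℳ) : (U ⊓ V).IsHomogeneous ℳ :=
  fun g _ hx => ⟨hU g hx.1, hV g hx.2⟩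

theorem isHomogeneous_bot {S : Type*} [Semiring S] [Module S M] :
    (⊥ : Submodule S M).IsHomogeneous ℳ := by
  intro g x hx
  rw [Submodule.mem_bot] at hx
  subst hx
  exact (Submodule.mem_bot S).2 (map_zero (component ℳ g))

theorem isHomogeneous_top {S : Type*} [Semiring S] [Module S M] :
    (⊤ : Submodule S M).IsHomogeneous ℳ := fun _ _ _ => Submodule.mem_top

/-- A family of additive endomorphisms `π g` which behave like the projections onto the subgroups
`ℳ g` and sum to the identity gives a decomposition. -/
@[reducible]
noncomputable def decompositionOfProjections {M : Type*} [AddCommGroup M] (ℳ : G → AddSubgroup M)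
    (π : G → M →+ M) (hmem : ∀ g x, π g x ∈ ℳ g) (hsame : ∀ g, ∀ x ∈ ℳ g, π g x = x)
    (hne : ∀ g k, ∀ x ∈ ℳ g, g ≠ k → π k x = 0)
    (hsum : ∀ x, ∃ s : Finset G, ∑ g ∈ s, π g x = x) : Decomposition ℳ := by
  refine IsInternal.chooseDecomposition ℳ ⟨?_, fun x => ?_⟩
  · refine (injective_iff_map_eq_zero (DirectSum.coeAddMonoidHom ℳ)).2 fun f hf => ?_
    have key : ∀ (f : ⨁ g, ℳ g) (k : G), π k (DirectSum.coeAddMonoidHom ℳ f) = f k := by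
      intro f k
      induction f using DirectSum.induction_on with
      | zero => simp
      | of g x =>
        rw [DirectSum.coeAddMonoidHom_of]
        by_cases h : g = k
        · subst h
          rw [hsame _ _ x.2, DirectSum.of_eq_same]
        · rw [hne g k _ x.2 h, DirectSum.of_eq_of_ne _ _ _ (Ne.symm h)]
          rfl
      | add f₁ f₂ h₁ h₂ => rw [map_add, map_add, h₁, h₂]; rfl
    ext k
    rw [← key, hf, map_zero]
    rfl
  · obtain ⟨s, hs⟩ := hsum x
    refine ⟨∑ g ∈ s, DirectSum.of (fun g => ℳ g) g ⟨π g x, hmem g x⟩, ?_⟩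
    rw [map_sum]
    simpa only [DirectSum.coeAddMonoidHom_of] using hs

end Components

/-! ### Components in graded modules -/

section GradedModule

variable {G : Type v} [AddGroup G] [DecidableEq G] {R : Type u} [Ring R]
  (𝒜 : G → AddSubgroup R) [GradedRing 𝒜] {M : Type*} [AddCommGroup M] [Module R M]
  (ℳ : G → AddSubgroup M) [Decomposition ℳ] [SetLike.GradedSMul 𝒜 ℳ]

theorem component_smul_of_right_mem {j : G} {x : M} (hx : x ∈ ℳ j) (i : G) (r : R) :
    component ℳ (i + j) (r • x) = component 𝒜 i r • x := by
  induction r using Decomposition.inductionOn 𝒜 with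
  | zero => simp
  | @homogeneous k m =>
    have hm : (m : R) • x ∈ ℳ (k + j) := SetLike.GradedSMul.smul_mem m.2 hx
    by_cases h : k = i
    · subst h
      rw [component_of_mem ℳ hm, component_of_mem 𝒜 m.2]
    · rw [component_of_mem_ne ℳ hm (by simpa using h), component_of_mem_ne 𝒜 m.2 h, zero_smul]
  | add r s hr hs => rw [add_smul, map_add, map_add, hr, hs, add_smul]

end GradedModule

/-! ### Graded one-sided ideals and annihilators -/

section Rings

variable {G : Type v} [AddGroup G] [DecidableEq G] {R : Type u} [Ring R]
  {𝒜 : G → AddSubgroup R} [GradedRing 𝒜]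

theorem component_mul_of_left_mem {i : G} {a : R} (ha : a ∈ 𝒜 i) (j : G) (b : R) :
    component 𝒜 (i + j) (a * b) = a * component 𝒜 j b :=
  coe_decompose_mul_add_of_left_mem 𝒜 ha

theorem component_mul_of_right_mem {j : G} {b : R} (hb : b ∈ 𝒜 j) (i : G) (a : R) :
    component 𝒜 (i + j) (a * b) = component 𝒜 i a * b :=
  coe_decompose_mul_add_of_right_mem 𝒜 hb

theorem mul_mem_degree {i j : G} {a b : R} (ha : a ∈ 𝒜 i) (hb : b ∈ 𝒜 j) : a * b ∈ 𝒜 (i + j) :=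
  SetLike.GradedMul.mul_mem ha hb

theorem component_mul_of_left_mem' {i : G} {a : R} (ha : a ∈ 𝒜 i) (j : G) (b : R) :
    component 𝒜 j (a * b) = a * component 𝒜 (-i + j) b := by
  rw [← component_mul_of_left_mem ha, add_neg_cancel_left]

theorem component_mul_of_right_mem' {j : G} {b : R} (hb : b ∈ 𝒜 j) (i : G) (a : R) :
    component 𝒜 i (a * b) = component 𝒜 (i - j) a * b := by
  rw [← component_mul_of_right_mem hb, sub_add_cancel]

theorem mem_span_left {x y : R} : y ∈ Submodule.span R {x} ↔ ∃ r, y = r * x := by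
  simp [Submodule.mem_span_singleton, eq_comm]

theorem mem_span_right {x y : R} : y ∈ Submodule.span Rᵐᵒᵖ {x} ↔ ∃ r, y = x * r := by
  rw [Submodule.mem_span_singleton]
  exact ⟨fun ⟨r, hr⟩ => ⟨r.unop, hr.symm⟩, fun ⟨r, hr⟩ => ⟨.op r, hr.symm⟩⟩

theorem right_mul_mem {A : Submodule Rᵐᵒᵖ R} {x : R} (hx : x ∈ A) (r : R) : x * r ∈ A :=
  A.smul_mem (.op r) hx

theorem left_mul_mem {U : Submodule R R} {x : R} (r : R) (hx : x ∈ U) : r * x ∈ U :=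
  U.smul_mem r hx

theorem isHomogeneous_span_left {i : G} {x : R} (hx : x ∈ 𝒜 i) :
    (Submodule.span R {x}).IsHomogeneous 𝒜 := by
  intro g y hy
  obtain ⟨r, rfl⟩ := mem_span_left.1 hy
  exact mem_span_left.2 ⟨_, component_mul_of_right_mem' hx g r⟩

theorem isHomogeneous_span_right {i : G} {x : R} (hx : x ∈ 𝒜 i) :
    (Submodule.span Rᵐᵒᵖ {x}).IsHomogeneous 𝒜 := by
  intro g y hy
  obtain ⟨r, rfl⟩ := mem_span_right.1 hy
  exact mem_span_right.2 ⟨_, component_mul_of_left_mem' hx g r⟩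

/-- If a homogeneous element is congruent to a right multiple of a homogeneous element, the
multiplier can be taken homogeneous of the expected degree. -/
theorem exists_homogeneous_right_multiplier {S : Type*} [Semiring S] [Module S R]
    {I : Submodule S R} (hI : I.IsHomogeneous 𝒜)
    {i j : G} {x y r : R} (hx : x ∈ 𝒜 i) (hy : y ∈ 𝒜 j) (h : y - x * r ∈ I) :
    ∃ t ∈ 𝒜 (-i + j), y - x * t ∈ I := by
  refine ⟨component 𝒜 (-i + j) r, component_mem _ _ _, ?_⟩
  have := hI j h
  change component 𝒜 j (y - x * r) ∈ I at this
  rwa [map_sub, component_of_mem 𝒜 hy, component_mul_of_left_mem' hx] at this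

/-- The left ideal `{r | r x ∈ U}`. -/
def leftColon (U : Submodule R R) (x : R) : Submodule R R :=
  U.comap (LinearMap.toSpanSingleton R R x)

theorem mem_leftColon {U : Submodule R R} {x r : R} : r ∈ leftColon U x ↔ r * x ∈ U := Iff.rfl

theorem mem_leftColon_bot {x r : R} : r ∈ leftColon ⊥ x ↔ r * x = 0 := Submodule.mem_bot R

theorem isHomogeneous_leftColon {U : Submodule R R} (hU : U.IsHomogeneous 𝒜) {i : G} {x : R}
    (hx : x ∈ 𝒜 i) : (leftColon U x).IsHomogeneous 𝒜 := by
  intro g r hr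
  have := hU (g + i) (mem_leftColon.1 hr)
  change component 𝒜 (g + i) (r * x) ∈ U at this
  rwa [component_mul_of_right_mem hx] at this

theorem isHomogeneous_leftAnn {A : Submodule Rᵐᵒᵖ R} (hA : A.IsHomogeneous 𝒜) :
    (leftAnn (A : Set R)).IsHomogeneous 𝒜 := by
  intro g r hr s hs
  refine eq_zero_of_component 𝒜 fun k => ?_
  change component 𝒜 k (component 𝒜 g r * s) = 0
  rw [component_mul_of_left_mem' (component_mem 𝒜 g r),
    ← component_mul_of_right_mem (component_mem 𝒜 _ s), show r * component 𝒜 _ s = 0 from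
      hr _ (hA _ hs), map_zero]

theorem isHomogeneous_rightAnn {U : Submodule R R} (hU : U.IsHomogeneous 𝒜) :
    (rightAnn (U : Set R)).IsHomogeneous 𝒜 := by
  intro g r hr s hs
  refine eq_zero_of_component 𝒜 fun k => ?_
  change component 𝒜 k (s * component 𝒜 g r) = 0
  rw [component_mul_of_right_mem' (component_mem 𝒜 g r),
    ← component_mul_of_left_mem (component_mem 𝒜 _ s), show component 𝒜 _ s * r = 0 from
      hr _ (hU _ hs), map_zero]

theorem leftAnn_anti {S T : Set R} (h : S ⊆ T) : leftAnn T ≤ leftAnn S :=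
  fun _ hr s hs => hr s (h hs)

theorem rightAnn_anti {S T : Set R} (h : S ⊆ T) : rightAnn T ≤ rightAnn S :=
  fun _ hr s hs => hr s (h hs)

theorem le_rightAnn_leftAnn (A : Submodule Rᵐᵒᵖ R) : A ≤ rightAnn (leftAnn (A : Set R) : Set R) :=
  fun _ hx _ hr => hr _ hx

theorem le_leftAnn_rightAnn (U : Submodule R R) : U ≤ leftAnn (rightAnn (U : Set R) : Set R) :=
  fun _ hx _ hr => hr _ hx

theorem leftAnn_sup (A B : Submodule Rᵐᵒᵖ R) :
    leftAnn ((A ⊔ B : Submodule Rᵐᵒᵖ R) : Set R) = leftAnn (A : Set R) ⊓ leftAnn (B : Set R) := by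
  refine le_antisymm (le_inf (leftAnn_anti (le_sup_left (a := A)))
    (leftAnn_anti (le_sup_right (a := A)))) fun r hr s hs => ?_
  obtain ⟨a, ha, b, hb, rfl⟩ := Submodule.mem_sup.1 hs
  rw [mul_add, hr.1 a ha, hr.2 b hb, add_zero]

theorem mem_leftAnn_span_right {x r : R} :
    r ∈ leftAnn (Submodule.span Rᵐᵒᵖ {x} : Set R) ↔ r * x = 0 := by
  refine ⟨fun h => h x (Submodule.mem_span_singleton_self x), fun h s hs => ?_⟩
  obtain ⟨t, rfl⟩ := mem_span_right.1 hs
  rw [← mul_assoc, h, zero_mul]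

theorem exists_maximal_homogeneous {S : Type*} [Semiring S] [Module S R]
    (h : WellFoundedGT {U : Submodule S R // U.IsHomogeneous 𝒜}) (p : Submodule S R → Prop)
    (hp : ∃ U : Submodule S R, U.IsHomogeneous 𝒜 ∧ p U) :
    ∃ U : Submodule S R, U.IsHomogeneous 𝒜 ∧ p U ∧
      ∀ V : Submodule S R, V.IsHomogeneous 𝒜 → p V → U ≤ V → V ≤ U := by
  obtain ⟨U₀, hU₀, hpU₀⟩ := hp
  obtain ⟨⟨U, hU⟩, hpU, hmax⟩ := h.wf.has_min {U | p U.1} ⟨⟨U₀, hU₀⟩, hpU₀⟩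
  refine ⟨U, hU, hpU, fun V hV hpV hle => ?_⟩
  by_contra hn
  exact hmax ⟨V, hV⟩ hpV (lt_of_le_not_ge (show U ≤ V from hle) hn)

theorem exists_minimal_homogeneous {S : Type*} [Semiring S] [Module S R]
    (h : WellFoundedLT {U : Submodule S R // U.IsHomogeneous 𝒜}) (p : Submodule S R → Prop)
    (hp : ∃ U : Submodule S R, U.IsHomogeneous 𝒜 ∧ p U) :
    ∃ U : Submodule S R, U.IsHomogeneous 𝒜 ∧ p U ∧
      ∀ V : Submodule S R, V.IsHomogeneous 𝒜 → p V → V ≤ U → U ≤ V := by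
  obtain ⟨U₀, hU₀, hpU₀⟩ := hp
  obtain ⟨⟨U, hU⟩, hpU, hmin⟩ := h.wf.has_min {U | p U.1} ⟨⟨U₀, hU₀⟩, hpU₀⟩
  refine ⟨U, hU, hpU, fun V hV hpV hle => ?_⟩
  by_contra hn
  exact hmin ⟨V, hV⟩ hpV (lt_of_le_not_ge (show V ≤ U from hle) hn)

end Rings

/-! ### Consequences of graded self-injectivity -/

section SelfInjective

variable {G : Type v} [AddGroup G] [DecidableEq G] {R : Type u} [Ring R]
  {𝒜 : G → AddSubgroup R} [GradedRing 𝒜]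

/-- Self-injectivity in terms of graphs: a graded submodule `Γ` of `R × R` which is the graph of a
partially defined linear map of degree `h` is contained in the graph of the right multiplication
by a homogeneous element of degree `h`. -/
theorem IsGradedLeftSelfInjective.exists_right_multiplier (hinj : IsGradedLeftSelfInjective 𝒜)
    (h : G) (Γ : Submodule R (R × R)) (hfun : ∀ y, ((0 : R), y) ∈ Γ → y = 0)
    (hgr : ∀ p ∈ Γ, ∀ g, (component 𝒜 g p.1, component 𝒜 (g + h) p.2) ∈ Γ) :
    ∃ c ∈ 𝒜 h, ∀ p ∈ Γ, p.2 = p.1 * c := by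
  -- The map has degree zero as a map from the shift of `R` by `-h` to `R`.
  let 𝒩 : G → AddSubgroup R := fun g => 𝒜 (g - h)
  let ℳ : G → AddSubgroup Γ := fun g =>
    ((𝒩 g).prod (𝒜 g)).comap Γ.subtype.toAddMonoidHom
  have hgr' : ∀ p ∈ Γ, ∀ g, (component 𝒜 (g - h) p.1, component 𝒜 g p.2) ∈ Γ := fun p hp g => by
    simpa using hgr p hp (g - h)
  have hfst : ∀ p q : Γ, p.1.1 = q.1.1 → p = q := fun p q hpq => by
    have h0 : ((0 : R), (p - q).1.2) ∈ Γ := by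
      have h1 : (p - q).1 = (0, (p - q).1.2) := Prod.ext (sub_eq_zero.2 hpq) rfl
      exact h1 ▸ (p - q).2
    exact Subtype.ext (Prod.ext hpq (sub_eq_zero.1 (hfun _ h0)))
  let π : G → R →+ R := fun g => component 𝒜 (g - h)
  let ρ : G → Γ →+ Γ := fun g => AddMonoidHom.mk'
    (fun p => ⟨(component 𝒜 (g - h) p.1.1, component 𝒜 g p.1.2), hgr' _ p.2 g⟩)
    fun p q => Subtype.ext (Prod.ext (map_add _ _ _) (map_add _ _ _))
  have hsum : ∀ x : R, ∃ s : Finset G, ∑ g ∈ s, component 𝒜 (g - h) x = x := fun x => by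
    obtain ⟨s, hs⟩ := exists_sum_component 𝒜 x
    refine ⟨s.map (addRightEmbedding h), ?_⟩
    simpa using hs
  let dN : Decomposition 𝒩 := decompositionOfProjections 𝒩 π
    (fun g x => component_mem 𝒜 _ x) (fun g x hx => component_of_mem 𝒜 hx)
    (fun g k x hx hgk => component_of_mem_ne 𝒜 hx (by simpa using hgk)) hsum
  let dM : Decomposition ℳ := decompositionOfProjections ℳ ρ
    (fun g p => ⟨component_mem 𝒜 _ _, component_mem 𝒜 _ _⟩)
    (fun g p hp => Subtype.ext (Prod.ext (component_of_mem 𝒜 hp.1) (component_of_mem 𝒜 hp.2)))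
    (fun g k p hp hgk => Subtype.ext (Prod.ext
      (component_of_mem_ne 𝒜 hp.1 (by simpa using hgk)) (component_of_mem_ne 𝒜 hp.2 hgk)))
    (fun p => by
      obtain ⟨s, hs⟩ := hsum p.1.1
      refine ⟨s, hfst _ _ ?_⟩
      rw [← hs]
      simp [ρ, Prod.fst_sum])
  have hN : SetLike.GradedSMul 𝒜 𝒩 := ⟨fun i j a b ha hb => by
    have := mul_mem_degree ha hb
    rwa [← add_sub_assoc] at this⟩
  have hM : SetLike.GradedSMul 𝒜 ℳ := ⟨fun i j a p ha hp =>
    ⟨hN.smul_mem ha hp.1, mul_mem_degree ha hp.2⟩⟩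
  obtain ⟨f, hf, hfΓ⟩ := hinj Γ R ℳ 𝒩 ((LinearMap.fst R R R).comp Γ.subtype)
    ((LinearMap.snd R R R).comp Γ.subtype) (fun g p hp => hp.1) (fun p q hpq => hfst p q hpq)
    (fun g p hp => hp.2)
  refine ⟨f 1, hf h 1 ?_, fun p hp => ?_⟩
  · change (1 : R) ∈ 𝒜 (h - h)
    rw [sub_self]
    exact SetLike.GradedOne.one_mem
  · have := hfΓ ⟨p, hp⟩
    change f p.1 = p.2 at this
    rw [← this, ← smul_eq_mul, ← map_smul, smul_eq_mul, mul_one]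

/-- A homogeneous element `z` of the right degree is obtained from `x` by right multiplication with
an element annihilating the graded left ideal `U`, provided that `r x ∈ U` forces `r z = 0`. -/
theorem IsGradedLeftSelfInjective.exists_mem_rightAnn_mul_eq (hinj : IsGradedLeftSelfInjective 𝒜)
    {U : Submodule R R} (hU : U.IsHomogeneous 𝒜) {i j : G} {x z : R} (hx : x ∈ 𝒜 i)
    (hz : z ∈ 𝒜 j) (h : ∀ r, r * x ∈ U → r * z = 0) :
    ∃ c ∈ rightAnn (U : Set R), x * c = z := by
  let Γ : Submodule R (R × R) := U.map (LinearMap.inl R R R) ⊔ Submodule.span R {(x, z)}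
  have hΓ : ∀ {p : R × R}, p ∈ Γ ↔ ∃ u ∈ U, ∃ r, p = (u + r * x, r * z) := fun {p} => by
    simp only [Γ, Submodule.mem_sup, Submodule.mem_map, Submodule.mem_span_singleton]
    constructor
    · rintro ⟨_, ⟨u, hu, rfl⟩, _, ⟨r, rfl⟩, rfl⟩
      exact ⟨u, hu, r, by simp⟩
    · rintro ⟨u, hu, r, rfl⟩
      exact ⟨_, ⟨u, hu, rfl⟩, _, ⟨r, rfl⟩, by simp⟩
  have hfun : ∀ y, ((0 : R), y) ∈ Γ → y = 0 := by
    intro y hy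
    obtain ⟨u, hu, r, he⟩ := hΓ.1 hy
    obtain ⟨h1, rfl⟩ := Prod.mk.inj he
    refine h r ?_
    rw [eq_neg_of_add_eq_zero_right h1.symm]
    exact U.neg_mem hu
  have hgr : ∀ p ∈ Γ, ∀ g, (component 𝒜 g p.1, component 𝒜 (g + (-i + j)) p.2) ∈ Γ := by
    intro p hp g
    obtain ⟨u, hu, r, rfl⟩ := hΓ.1 hp
    refine hΓ.2 ⟨component 𝒜 g u, hU g hu, component 𝒜 (g - i) r, ?_⟩
    simp only [map_add, component_mul_of_right_mem' hx, component_mul_of_right_mem' hz]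
    congr 3
    rw [← add_assoc, add_sub_cancel_right, ← sub_eq_add_neg]
  obtain ⟨c, -, hc⟩ := hinj.exists_right_multiplier (-i + j) Γ hfun hgr
  refine ⟨c, fun u hu => ?_, ?_⟩
  · simpa using (hc _ (hΓ.2 ⟨u, hu, 0, rfl⟩)).symm
  · simpa using (hc _ (hΓ.2 ⟨0, U.zero_mem, 1, rfl⟩)).symm

theorem IsGradedLeftSelfInjective.exists_eq_mul (hinj : IsGradedLeftSelfInjective 𝒜) {i j : G}
    {a b : R} (ha : a ∈ 𝒜 i) (hb : b ∈ 𝒜 j) (h : ∀ r, r * a = 0 → r * b = 0) :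
    ∃ c, b = a * c := by
  obtain ⟨c, -, hc⟩ := hinj.exists_mem_rightAnn_mul_eq isHomogeneous_bot ha hb
    fun r hr => h r (by simpa using hr)
  exact ⟨c, hc.symm⟩

/-- In a graded left self-injective ring, `ann_r (U ∩ V) = ann_r U + ann_r V` for graded left
ideals. -/
theorem IsGradedLeftSelfInjective.rightAnn_inf (hinj : IsGradedLeftSelfInjective 𝒜)
    {U V : Submodule R R} (hU : U.IsHomogeneous 𝒜) (hV : V.IsHomogeneous 𝒜) :
    rightAnn ((U ⊓ V : Submodule R R) : Set R) =
      rightAnn (U : Set R) ⊔ rightAnn (V : Set R) := by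
  refine le_antisymm (le_of_homogeneous_mem (isHomogeneous_rightAnn (isHomogeneous_inf hU hV))
    fun h x hx hxUV => ?_)
    (sup_le (rightAnn_anti (inf_le_left (a := U))) (rightAnn_anti (inf_le_right (a := U))))
  -- The map `u + v ↦ u x` on `U + V`.
  let Γ : Submodule R (R × R) :=
    U.map (LinearMap.prod LinearMap.id (LinearMap.toSpanSingleton R R x)) ⊔
      V.map (LinearMap.inl R R R)
  have hΓ : ∀ {p : R × R}, p ∈ Γ ↔ ∃ u ∈ U, ∃ v ∈ V, p = (u + v, u * x) := fun {p} => by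
    simp only [Γ, Submodule.mem_sup, Submodule.mem_map]
    constructor
    · rintro ⟨_, ⟨u, hu, rfl⟩, _, ⟨v, hv, rfl⟩, rfl⟩
      exact ⟨u, hu, v, hv, by simp⟩
    · rintro ⟨u, hu, v, hv, rfl⟩
      exact ⟨_, ⟨u, hu, rfl⟩, _, ⟨v, hv, rfl⟩, by simp⟩
  have hfun : ∀ y, ((0 : R), y) ∈ Γ → y = 0 := by
    intro y hy
    obtain ⟨u, hu, v, hv, he⟩ := hΓ.1 hy
    obtain ⟨h1, rfl⟩ := Prod.mk.inj he
    refine hxUV u ⟨hu, ?_⟩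
    rw [eq_neg_of_add_eq_zero_left h1.symm]
    exact V.neg_mem hv
  have hgr : ∀ p ∈ Γ, ∀ g, (component 𝒜 g p.1, component 𝒜 (g + h) p.2) ∈ Γ := by
    intro p hp g
    obtain ⟨u, hu, v, hv, rfl⟩ := hΓ.1 hp
    exact hΓ.2 ⟨_, hU g hu, _, hV g hv, Prod.ext (map_add _ _ _)
      (component_mul_of_right_mem hx g u)⟩
  obtain ⟨c, -, hc⟩ := hinj.exists_right_multiplier h Γ hfun hgr
  refine Submodule.mem_sup.2 ⟨x - c, fun u hu => ?_, c, fun v hv => ?_, sub_add_cancel _ _⟩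
  · have := hc _ (hΓ.2 ⟨u, hu, 0, V.zero_mem, rfl⟩)
    simp only [add_zero] at this
    rw [mul_sub, this, sub_self]
  · simpa using (hc _ (hΓ.2 ⟨0, U.zero_mem, v, hv, rfl⟩)).symm

/-- In a graded left self-injective ring, the double annihilator condition passes from a graded
right ideal `B` to `B + x R` for homogeneous `x`. -/
theorem IsGradedLeftSelfInjective.rightAnn_leftAnn_sup_span
    (hinj : IsGradedLeftSelfInjective 𝒜) {B : Submodule Rᵐᵒᵖ R} (hB : B.IsHomogeneous 𝒜)
    (h : rightAnn (leftAnn (B : Set R) : Set R) = B) {i : G} {x : R} (hx : x ∈ 𝒜 i) :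
    rightAnn (leftAnn ((B ⊔ Submodule.span Rᵐᵒᵖ {x} : Submodule Rᵐᵒᵖ R) : Set R) : Set R) =
      B ⊔ Submodule.span Rᵐᵒᵖ {x} := by
  rw [leftAnn_sup, hinj.rightAnn_inf (isHomogeneous_leftAnn hB)
    (isHomogeneous_leftAnn (isHomogeneous_span_right hx)), h]
  congr 1
  refine le_antisymm (le_of_homogeneous_mem (isHomogeneous_rightAnn
    (isHomogeneous_leftAnn (isHomogeneous_span_right hx))) fun g y hy hyx => ?_)
    (le_rightAnn_leftAnn _)
  exact mem_span_right.2 (hinj.exists_eq_mul hx hy fun r hr =>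
    hyx r (mem_leftAnn_span_right.2 hr))

theorem rightAnn_leftAnn_bot :
    rightAnn (leftAnn ((⊥ : Submodule Rᵐᵒᵖ R) : Set R) : Set R) = ⊥ := by
  refine le_antisymm (fun x hx => ?_) bot_le
  have h1 : (1 : R) ∈ leftAnn ((⊥ : Submodule Rᵐᵒᵖ R) : Set R) := fun s hs => by
    rw [(Submodule.mem_bot _).1 hs, mul_zero]
  simpa using hx 1 h1

theorem IsGradedLeftSelfInjective.rightDoubleAnnihilator_of_isGradedRightNoetherian
    (hinj : IsGradedLeftSelfInjective 𝒜) (hN : IsGradedRightNoetherian 𝒜) :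
    RightDoubleAnnihilator 𝒜 := by
  intro A hA
  obtain ⟨B, hB, ⟨hBA, hBB⟩, hmax⟩ := exists_maximal_homogeneous hN
    (fun B => B ≤ A ∧ rightAnn (leftAnn (B : Set R) : Set R) = B)
    ⟨⊥, isHomogeneous_bot, bot_le, rightAnn_leftAnn_bot⟩
  suffices h : A ≤ B by rwa [le_antisymm h hBA]
  refine le_of_homogeneous_mem hA fun g x hx hxA => ?_
  exact hmax _ (isHomogeneous_sup hB (isHomogeneous_span_right hx))
    ⟨sup_le hBA ((Submodule.span_singleton_le_iff_mem _ _).2 hxA),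
      hinj.rightAnn_leftAnn_sup_span hB hBB hx⟩ le_sup_left
    (Submodule.mem_sup_right (Submodule.mem_span_singleton_self x))

theorem IsGradedLeftSelfInjective.rightDoubleAnnihilator_of_isGradedLeftArtinian
    (hinj : IsGradedLeftSelfInjective 𝒜) (hA : IsGradedLeftArtinian 𝒜) :
    RightDoubleAnnihilator 𝒜 := by
  intro A hA'
  obtain ⟨_, -, ⟨B, hB, hBA, hBB, rfl⟩, hmin⟩ := exists_minimal_homogeneous hA
    (fun L => ∃ B : Submodule Rᵐᵒᵖ R, B.IsHomogeneous 𝒜 ∧ B ≤ A ∧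
      rightAnn (leftAnn (B : Set R) : Set R) = B ∧ leftAnn (B : Set R) = L)
    ⟨_, isHomogeneous_leftAnn isHomogeneous_bot, ⊥, isHomogeneous_bot, bot_le,
      rightAnn_leftAnn_bot, rfl⟩
  suffices h : A ≤ B by rwa [le_antisymm h hBA]
  refine le_of_homogeneous_mem hA' fun g x hx hxA => ?_
  have hB' := isHomogeneous_sup hB (isHomogeneous_span_right hx)
  have h1 := hinj.rightAnn_leftAnn_sup_span hB hBB hx
  have h2 := hmin _ (isHomogeneous_leftAnn hB')
    ⟨_, hB', sup_le hBA ((Submodule.span_singleton_le_iff_mem _ _).2 hxA), h1, rfl⟩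
    (leftAnn_anti (le_sup_left (a := B)))
  rw [← hBB]
  refine rightAnn_anti h2 ?_
  exact le_rightAnn_leftAnn _ (Submodule.mem_sup_right (Submodule.mem_span_singleton_self x))

end SelfInjective

/-! ### Transfer of chain conditions along annihilators -/

section Duality

variable {G : Type v} [AddGroup G] [DecidableEq G] {R : Type u} [Ring R]
  {𝒜 : G → AddSubgroup R} [GradedRing 𝒜]

/-- The double annihilator condition makes `ann_l` strictly antitone on graded right ideals. -/
theorem RightDoubleAnnihilator.isGradedRightNoetherian (h : RightDoubleAnnihilator 𝒜)
    (hA : IsGradedLeftArtinian 𝒜) : IsGradedRightNoetherian 𝒜 := by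
  have : WellFoundedLT (GradedLeftIdeal 𝒜) := hA
  refine (StrictAnti.wellFoundedGT (f := fun A : GradedRightIdeal 𝒜 =>
    (⟨leftAnn (A.1 : Set R), isHomogeneous_leftAnn A.2⟩ : GradedLeftIdeal 𝒜)) fun A B hAB => ?_)
  refine lt_of_le_not_ge (leftAnn_anti hAB.le : leftAnn (B.1 : Set R) ≤ leftAnn (A.1 : Set R))
    fun hle => hAB.not_ge ?_
  change B.1 ≤ A.1
  rw [← h A.1 A.2, ← h B.1 B.2]
  exact rightAnn_anti (show leftAnn (A.1 : Set R) ≤ leftAnn (B.1 : Set R) from hle)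

theorem LeftDoubleAnnihilator.isGradedLeftNoetherian (h : LeftDoubleAnnihilator 𝒜)
    (hA : IsGradedRightArtinian 𝒜) : IsGradedLeftNoetherian 𝒜 := by
  have : WellFoundedLT (GradedRightIdeal 𝒜) := hA
  refine (StrictAnti.wellFoundedGT (f := fun A : GradedLeftIdeal 𝒜 =>
    (⟨rightAnn (A.1 : Set R), isHomogeneous_rightAnn A.2⟩ : GradedRightIdeal 𝒜))
    fun A B hAB => ?_)
  refine lt_of_le_not_ge (rightAnn_anti hAB.le : rightAnn (B.1 : Set R) ≤ rightAnn (A.1 : Set R))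
    fun hle => hAB.not_ge ?_
  change B.1 ≤ A.1
  rw [← h A.1 A.2, ← h B.1 B.2]
  exact leftAnn_anti (show rightAnn (A.1 : Set R) ≤ rightAnn (B.1 : Set R) from hle)

theorem LeftDoubleAnnihilator.isGradedLeftArtinian (h : LeftDoubleAnnihilator 𝒜)
    (hA : IsGradedRightNoetherian 𝒜) : IsGradedLeftArtinian 𝒜 := by
  have : WellFoundedGT (GradedRightIdeal 𝒜) := hA
  refine (StrictAnti.wellFoundedLT (f := fun A : GradedLeftIdeal 𝒜 =>
    (⟨rightAnn (A.1 : Set R), isHomogeneous_rightAnn A.2⟩ : GradedRightIdeal 𝒜))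
    fun A B hAB => ?_)
  refine lt_of_le_not_ge (rightAnn_anti hAB.le : rightAnn (B.1 : Set R) ≤ rightAnn (A.1 : Set R))
    fun hle => hAB.not_ge ?_
  change B.1 ≤ A.1
  rw [← h A.1 A.2, ← h B.1 B.2]
  exact leftAnn_anti (show rightAnn (A.1 : Set R) ≤ rightAnn (B.1 : Set R) from hle)

end Duality

/-! ### Self-injectivity from the double annihilator conditions -/

section Baer

variable {G : Type v} [AddGroup G] [DecidableEq G] {R : Type u} [Ring R]
  {𝒜 : G → AddSubgroup R} [GradedRing 𝒜]

/-- A graded form of Baer's criterion, phrased with graphs of partially defined linear maps of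
arbitrary degree on `R`. -/
theorem isGradedLeftSelfInjective_of_right_multipliers
    (hB : ∀ (h : G) (Γ : Submodule R (R × R)), (∀ y, ((0 : R), y) ∈ Γ → y = 0) →
      (∀ p ∈ Γ, ∀ g, (component 𝒜 g p.1, component 𝒜 (g + h) p.2) ∈ Γ) →
      ∃ c ∈ 𝒜 h, ∀ p ∈ Γ, p.2 = p.1 * c) :
    IsGradedLeftSelfInjective 𝒜 := by
  intro M N _ _ _ _ ℳ 𝒩 _ _ _ _ i f hi hinj hf
  -- Partial extensions of `f` are represented by their graphs in `N × R`.
  let P : Set (Submodule R (N × R)) := {Γ | (∀ y, ((0 : N), y) ∈ Γ → y = 0) ∧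
    ∀ p ∈ Γ, ∀ g, (component 𝒩 g p.1, component 𝒜 g p.2) ∈ Γ}
  let Γ₀ : Submodule R (N × R) := LinearMap.range (LinearMap.prod i f)
  have hcomp : ∀ g x, component 𝒩 g (i x) = i (component ℳ g x) ∧
      component 𝒜 g (f x) = f (component ℳ g x) := by
    intro g x
    induction x using Decomposition.inductionOn ℳ with
    | zero => simp
    | @homogeneous k m =>
      by_cases h : k = g
      · subst h
        rw [component_of_mem ℳ m.2]
        exact ⟨component_of_mem _ (hi _ _ m.2), component_of_mem _ (hf _ _ m.2)⟩
      · rw [component_of_mem_ne ℳ m.2 h, map_zero, map_zero]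
        exact ⟨component_of_mem_ne _ (hi _ _ m.2) h, component_of_mem_ne _ (hf _ _ m.2) h⟩
    | add x y hx hy => simp [hx, hy]
  have hΓ₀ : Γ₀ ∈ P := by
    constructor
    · rintro y ⟨x, hx⟩
      obtain ⟨h1, h2⟩ := Prod.mk.inj (hx : (i x, f x) = (0, y))
      rw [← h2, hinj (h1.trans (map_zero i).symm), map_zero]
    · rintro _ ⟨x, rfl⟩ g
      exact ⟨component ℳ g x, Prod.ext (hcomp g x).1.symm (hcomp g x).2.symm⟩
  obtain ⟨Γ, hle, hΓ⟩ := zorn_le_nonempty₀ P (fun c hcP hc Γ₁ hΓ₁ => by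
    have hdir : DirectedOn (· ≤ ·) c := hc.directedOn
    refine ⟨sSup c, ⟨fun y hy => ?_, fun p hp g => ?_⟩, fun _ => le_sSup⟩
    · obtain ⟨Δ, hΔ, hyΔ⟩ := (Submodule.mem_sSup_of_directed ⟨Γ₁, hΓ₁⟩ hdir).1 hy
      exact (hcP hΔ).1 y hyΔ
    · obtain ⟨Δ, hΔ, hpΔ⟩ := (Submodule.mem_sSup_of_directed ⟨Γ₁, hΓ₁⟩ hdir).1 hp
      exact (le_sSup hΔ : Δ ≤ _) ((hcP hΔ).2 p hpΔ g)) Γ₀ hΓ₀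
  obtain ⟨⟨hfun, hgr⟩, hmax⟩ := hΓ
  -- The domain of a maximal extension contains every homogeneous element.
  have hdom : ∀ g, ∀ n ∈ 𝒩 g, ∃ c, (n, c) ∈ Γ := by
    intro g n hn
    let Δ : Submodule R (R × R) :=
      Γ.comap (LinearMap.prodMap (LinearMap.toSpanSingleton R N n) LinearMap.id)
    have hΔ : ∀ {p : R × R}, p ∈ Δ ↔ (p.1 • n, p.2) ∈ Γ := Iff.rfl
    obtain ⟨c, hc, hcΔ⟩ := hB g Δ (fun y hy => hfun y (by simpa using hΔ.1 hy))
      (fun p hp k => by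
        have := hgr _ (hΔ.1 hp) (k + g)
        rw [component_smul_of_right_mem 𝒜 𝒩 hn] at this
        exact hΔ.2 this)
    refine ⟨c, hmax (y := Γ ⊔ Submodule.span R {(n, c)}) ⟨fun y hy => ?_, fun p hp k => ?_⟩
      le_sup_left (Submodule.mem_sup_right (Submodule.mem_span_singleton_self _))⟩
    · obtain ⟨⟨d, z⟩, hd, _, hq, he⟩ := Submodule.mem_sup.1 hy
      obtain ⟨r, rfl⟩ := Submodule.mem_span_singleton.1 hq
      obtain ⟨h1, h2⟩ := Prod.mk.inj (he : (d + r • n, z + r • c) = (0, y))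
      have h3 : (r, -z) ∈ Δ := by
        have := Γ.neg_mem hd
        rwa [Prod.neg_mk, ← eq_neg_of_add_eq_zero_right h1] at this
      have h4 : -z = r * c := hcΔ _ h3
      have h5 : z + r * c = y := h2
      rw [← h5, ← h4, add_neg_cancel]
    · obtain ⟨q, hd, _, hq, rfl⟩ := Submodule.mem_sup.1 hp
      obtain ⟨r, rfl⟩ := Submodule.mem_span_singleton.1 hq
      refine Submodule.mem_sup.2 ⟨_, hgr q hd k, component 𝒜 (k - g) r • (n, c),
        Submodule.mem_span_singleton.2 ⟨_, rfl⟩, ?_⟩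
      have h1 := component_smul_of_right_mem 𝒜 𝒩 hn (k - g) r
      have h2 := component_mul_of_right_mem hc (k - g) r
      rw [sub_add_cancel] at h1 h2
      exact Prod.ext (by simp [h1]) (by simp [h2])
  have hdom' : ∀ n : N, ∃ c, (n, c) ∈ Γ := by
    intro n
    have : n ∈ Γ.map (LinearMap.fst R N R) := by
      refine mem_of_component_mem 𝒩 _ fun g => ?_
      obtain ⟨c, hc⟩ := hdom g _ (component_mem 𝒩 g n)
      exact ⟨_, hc, rfl⟩
    obtain ⟨⟨m, c⟩, hc, rfl⟩ := this
    exact ⟨c, hc⟩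
  have huniq : ∀ n c d, (n, c) ∈ Γ → (n, d) ∈ Γ → c = d := fun n c d hc hd =>
    sub_eq_zero.1 (hfun _ (by simpa using Γ.sub_mem hc hd))
  choose e he using hdom'
  refine ⟨{ toFun := e
            map_add' := fun m n => huniq _ _ _ (he _) (Γ.add_mem (he m) (he n))
            map_smul' := fun r n => huniq _ _ _ (he _) (Γ.smul_mem r (he n)) },
    fun g n hn => ?_, fun x => huniq _ _ _ (he _) (hle ⟨x, rfl⟩)⟩
  have h1 := hgr _ (he n) g
  rw [component_of_mem 𝒩 hn] at h1
  change e n ∈ 𝒜 g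
  rw [huniq _ _ _ (he n) h1]
  exact component_mem 𝒜 g _

theorem LeftDoubleAnnihilator.rightAnn_inf (hl : LeftDoubleAnnihilator 𝒜)
    (hr : RightDoubleAnnihilator 𝒜) {U V : Submodule R R} (hU : U.IsHomogeneous 𝒜)
    (hV : V.IsHomogeneous 𝒜) :
    rightAnn ((U ⊓ V : Submodule R R) : Set R) =
      rightAnn (U : Set R) ⊔ rightAnn (V : Set R) := by
  rw [← hr _ (isHomogeneous_sup (isHomogeneous_rightAnn hU) (isHomogeneous_rightAnn hV)),
    leftAnn_sup, hl U hU, hl V hV]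

/-- With both double annihilator conditions, a partially defined linear map is a right
multiplication on a finitely generated domain; the Noetherian hypothesis turns every graded domain
into such a one. -/
theorem IsGradedLeftNoetherian.isGradedLeftSelfInjective (hN : IsGradedLeftNoetherian 𝒜)
    (hr : RightDoubleAnnihilator 𝒜) (hl : LeftDoubleAnnihilator 𝒜) :
    IsGradedLeftSelfInjective 𝒜 := by
  refine isGradedLeftSelfInjective_of_right_multipliers fun h Γ hfun hgr => ?_
  obtain ⟨V, hV, ⟨c, hc, hcV⟩, hmax⟩ := exists_maximal_homogeneous hN
    (fun V => ∃ c ∈ 𝒜 h, ∀ p ∈ Γ, p.1 ∈ V → p.2 = p.1 * c)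
    ⟨⊥, isHomogeneous_bot, 0, zero_mem _, fun p hp h0 => by
      have h1 : p.1 = 0 := by simpa using h0
      rw [mul_zero]
      exact hfun _ (h1 ▸ hp)⟩
  refine ⟨c, hc, fun p hp => hcV p hp (mem_of_component_mem 𝒜 V fun g => ?_)⟩
  -- A homogeneous pair of the graph.
  obtain ⟨x, y, hx, hy, hxy, hxe⟩ : ∃ x y, x ∈ 𝒜 g ∧ y ∈ 𝒜 (g + h) ∧ (x, y) ∈ Γ ∧
      x = component 𝒜 g p.1 :=
    ⟨_, _, component_mem 𝒜 _ _, component_mem 𝒜 _ _, hgr p hp g, rfl⟩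
  rw [← hxe]
  have hspan := isHomogeneous_span_left hx
  -- The multiplier `d` on `R x`.
  have hyx : y ∈ rightAnn (leftAnn (Submodule.span Rᵐᵒᵖ {x} : Set R) : Set R) := fun r hrx => by
    have h0 := Γ.smul_mem r hxy
    rw [Prod.smul_mk, smul_eq_mul, smul_eq_mul, mem_leftAnn_span_right.1 hrx] at h0
    exact hfun _ h0
  rw [hr _ (isHomogeneous_span_right hx)] at hyx
  obtain ⟨d', hd'⟩ := mem_span_right.1 hyx
  obtain ⟨d, hd, hyd⟩ := exists_homogeneous_right_multiplier (S := R) isHomogeneous_bot hx hy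
    (r := d') (by simp [hd'])
  rw [Submodule.mem_bot, sub_eq_zero] at hyd
  rw [neg_add_cancel_left] at hd
  -- On `V ∩ R x` the multipliers `c` and `d` agree.
  have hcd : c - d ∈ rightAnn ((V ⊓ Submodule.span R {x} : Submodule R R) : Set R) := by
    rintro w ⟨hwV, hwx⟩
    obtain ⟨r, rfl⟩ := mem_span_left.1 hwx
    have h0 := hcV _ (Γ.smul_mem r hxy) hwV
    simp only [Prod.smul_mk, smul_eq_mul] at h0
    rw [mul_sub, ← h0, hyd, mul_assoc, sub_self]
  rw [hl.rightAnn_inf hr hV hspan] at hcd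
  obtain ⟨v, hv, w, hw, hvw⟩ := Submodule.mem_sup.1 hcd
  have hv' : component 𝒜 h v ∈ rightAnn (V : Set R) := isHomogeneous_rightAnn hV h hv
  have hw' : component 𝒜 h w ∈ rightAnn (Submodule.span R {x} : Set R) :=
    isHomogeneous_rightAnn hspan h hw
  have hvw' : c - component 𝒜 h v = d + component 𝒜 h w := by
    have := congrArg (component 𝒜 h) hvw
    rw [map_add, map_sub, component_of_mem 𝒜 hc, component_of_mem 𝒜 hd] at this
    rw [sub_eq_iff_eq_add, add_assoc, add_comm (component 𝒜 h w), this, add_sub_cancel]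
  refine hmax (V ⊔ Submodule.span R {x}) (isHomogeneous_sup hV hspan)
    ⟨c - component 𝒜 h v, sub_mem hc (component_mem 𝒜 h v), fun q hq hqV => ?_⟩ le_sup_left
    (Submodule.mem_sup_right (Submodule.mem_span_singleton_self x))
  obtain ⟨u, hu, z, hz, huz⟩ := Submodule.mem_sup.1 hqV
  obtain ⟨r, rfl⟩ := mem_span_left.1 hz
  have h1 := hcV _ (Γ.sub_mem hq (Γ.smul_mem r hxy))
  simp only [Prod.fst_sub, Prod.snd_sub, Prod.smul_mk, smul_eq_mul, ← huz,
    add_sub_cancel_right] at h1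
  have h2 := h1 hu
  have h3 : r * x * (c - component 𝒜 h v) = r * y := by
    rw [hvw', mul_add, show r * x * component 𝒜 h w = 0 from hw' _ hz, add_zero, mul_assoc, ← hyd]
  rw [← huz, add_mul, h3, mul_sub, show u * component 𝒜 h v = 0 from hv' u hu, sub_zero, ← h2,
    sub_add_cancel]

end Baer

/-! ### Graded two-sided ideals -/

section TwoSided

section

variable {G : Type v} {R : Type u} [Ring R] (𝒜 : G → AddSubgroup R)

/-- The left ideal generated by `I` and all `x q` with `q` homogeneous. It is two-sided if `I` is,
and graded if `x` is moreover homogeneous. -/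
def adjoinTwoSided (I : Submodule R R) (x : R) : Submodule R R :=
  I ⊔ Submodule.span R {y | ∃ q, SetLike.IsHomogeneousElem 𝒜 q ∧ y = x * q}

variable {𝒜}

/-- To map `adjoinTwoSided I x` into a left ideal, it suffices to map `I` and the elements
`x q`. -/
theorem adjoinTwoSided_le {I V : Submodule R R} {x : R} (hI : I ≤ V) (hx : ∀ q, x * q ∈ V) :
    adjoinTwoSided 𝒜 I x ≤ V := by
  refine sup_le hI (Submodule.span_le.2 ?_)
  rintro _ ⟨q, -, rfl⟩
  exact hx q

end

variable {G : Type v} [AddGroup G] [DecidableEq G] {R : Type u} [Ring R]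
  (𝒜 : G → AddSubgroup R) [GradedRing 𝒜]

/-- Graded two-sided ideals, as a predicate on left ideals. -/
structure IsTwoSidedGraded (I : Submodule R R) : Prop where
  homogeneous : I.IsHomogeneous 𝒜
  mul_right : ∀ x ∈ I, ∀ r, x * r ∈ I

variable {𝒜}

theorem mul_mul_mem_of_homogeneous {I : Submodule R R} {a b : R}
    (h : ∀ r, SetLike.IsHomogeneousElem 𝒜 r → a * r * b ∈ I) (r : R) : a * r * b ∈ I := by
  obtain ⟨s, hs⟩ := exists_sum_component 𝒜 r
  rw [← hs, Finset.mul_sum, Finset.sum_mul]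
  exact sum_mem fun g _ => h _ ⟨g, component_mem 𝒜 g r⟩

theorem mem_adjoinTwoSided (I : Submodule R R) (x : R) (q : R) :
    x * q ∈ adjoinTwoSided 𝒜 I x := by
  obtain ⟨s, hs⟩ := exists_sum_component 𝒜 q
  rw [← hs, Finset.mul_sum]
  exact sum_mem fun g _ => Submodule.mem_sup_right
    (Submodule.subset_span ⟨_, ⟨g, component_mem 𝒜 g q⟩, rfl⟩)

theorem self_mem_adjoinTwoSided (I : Submodule R R) (x : R) : x ∈ adjoinTwoSided 𝒜 I x := by
  simpa using mem_adjoinTwoSided (𝒜 := 𝒜) I x 1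

theorem isTwoSidedGraded_adjoinTwoSided {I : Submodule R R} (hI : IsTwoSidedGraded 𝒜 I) {i : G}
    {x : R} (hx : x ∈ 𝒜 i) : IsTwoSidedGraded 𝒜 (adjoinTwoSided 𝒜 I x) := by
  refine ⟨isHomogeneous_sup hI.homogeneous (Ideal.homogeneous_span 𝒜 _ ?_), fun y hy r => ?_⟩
  · rintro _ ⟨q, ⟨j, hq⟩, rfl⟩
    exact ⟨i + j, mul_mem_degree hx hq⟩
  · have : adjoinTwoSided 𝒜 I x ≤ leftColon (adjoinTwoSided 𝒜 I x) r := by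
      refine adjoinTwoSided_le (fun z hz => ?_) fun q => ?_
      · exact Submodule.mem_sup_left (hI.mul_right z hz r)
      · change x * q * r ∈ adjoinTwoSided 𝒜 I x
        rw [mul_assoc]
        exact mem_adjoinTwoSided I x _
    exact this hy

/-- If `a R b ⊆ I`, then the product of the two-sided ideals generated by `a` and `b` over `I` is
contained in `I`. -/
theorem mul_mem_of_mem_adjoinTwoSided {I : Submodule R R} (hI : IsTwoSidedGraded 𝒜 I) {a b : R}
    (h : ∀ r, a * r * b ∈ I) {y z : R} (hy : y ∈ adjoinTwoSided 𝒜 I a)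
    (hz : z ∈ adjoinTwoSided 𝒜 I b) : y * z ∈ I := by
  have key : ∀ q, a * q * z ∈ I := by
    intro q
    obtain ⟨u, hu, w, hw, rfl⟩ := Submodule.mem_sup.1 hz
    rw [mul_add]
    refine I.add_mem (left_mul_mem _ hu) ?_
    clear hz
    induction hw using Submodule.span_induction generalizing q with
    | mem w hw =>
      obtain ⟨p, -, rfl⟩ := hw
      rw [← mul_assoc]
      exact hI.mul_right _ (h q) p
    | zero => simp
    | add v w hv hw ihv ihw =>
      rw [mul_add]
      exact I.add_mem (ihv q) (ihw q)
    | smul r w hw ih =>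
      rw [smul_eq_mul, ← mul_assoc, mul_assoc a]
      exact ih (q * r)
  have : adjoinTwoSided 𝒜 I a ≤ leftColon I z :=
    adjoinTwoSided_le (fun u hu => hI.mul_right u hu z) key
  exact this hy

end TwoSided

/-! ### Descending chain conditions on intervals of graded left ideals -/

section ChainCondition

variable {G : Type v} [AddGroup G] [DecidableEq G] {R : Type u} [Ring R]
  (𝒜 : G → AddSubgroup R) [GradedRing 𝒜]

/-- Descending chain condition on the graded left ideals between `A` and `B`. -/
def IsArtinianBetween (A B : Submodule R R) : Prop :=
  ∀ f : ℕ → Submodule R R, Antitone f → (∀ n, (f n).IsHomogeneous 𝒜) →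
    (∀ n, A ≤ f n ∧ f n ≤ B) → ∃ n, ∀ m, n ≤ m → f m = f n

variable {𝒜}

theorem IsArtinianBetween.mono {A A' B B' : Submodule R R} (h : IsArtinianBetween 𝒜 A B)
    (hA : A ≤ A') (hB : B' ≤ B) : IsArtinianBetween 𝒜 A' B' :=
  fun f hf hf' hfAB => h f hf hf' fun n => ⟨hA.trans (hfAB n).1, (hfAB n).2.trans hB⟩

theorem isArtinianBetween_self (A : Submodule R R) : IsArtinianBetween 𝒜 A A :=
  fun _ _ _ h => ⟨0, fun m _ => (le_antisymm (h m).2 (h m).1).trans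
    (le_antisymm (h 0).2 (h 0).1).symm⟩

theorem IsArtinianBetween.trans {A B C : Submodule R R} (h₁ : IsArtinianBetween 𝒜 A B)
    (h₂ : IsArtinianBetween 𝒜 B C) (hB : B.IsHomogeneous 𝒜) (hAB : A ≤ B) (hBC : B ≤ C) :
    IsArtinianBetween 𝒜 A C := by
  intro f hf hf' hfAC
  obtain ⟨n₁, hn₁⟩ := h₁ (fun n => f n ⊓ B) (fun m n h => inf_le_inf_right _ (hf h))
    (fun n => isHomogeneous_inf (hf' n) hB) fun n => ⟨le_inf (hfAC n).1 hAB, inf_le_right⟩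
  obtain ⟨n₂, hn₂⟩ := h₂ (fun n => f n ⊔ B) (fun m n h => sup_le_sup_right (hf h) _)
    (fun n => isHomogeneous_sup (hf' n) hB) fun n => ⟨le_sup_right, sup_le (hfAC n).2 hBC⟩
  refine ⟨max n₁ n₂, fun m hm => eq_of_le_of_inf_le_of_sup_le (z := B) (hf hm) ?_ ?_⟩
  · rw [hn₁ m ((le_max_left _ _).trans hm), hn₁ _ (le_max_left _ _)]
  · rw [hn₂ m ((le_max_right _ _).trans hm), hn₂ _ (le_max_right _ _)]

/-- The cyclic module `(V + R x) / V` is a quotient of `R / L` whenever `L x ⊆ V`. -/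
theorem IsArtinianBetween.sup_span {L V : Submodule R R} (hL : IsArtinianBetween 𝒜 L ⊤) {i : G}
    {x : R} (hx : x ∈ 𝒜 i) (hLx : ∀ r ∈ L, r * x ∈ V) :
    IsArtinianBetween 𝒜 V (V ⊔ Submodule.span R {x}) := by
  intro f hf hf' hfV
  obtain ⟨n, hn⟩ := hL (fun n => leftColon (f n) x) (fun m n h _ hr => hf h hr)
    (fun n => isHomogeneous_leftColon (hf' n) hx) fun n =>
      ⟨fun r hr => (hfV n).1 (hLx r hr), le_top⟩
  refine ⟨n, fun m hm => le_antisymm (hf hm) fun w hw => ?_⟩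
  obtain ⟨v, hv, y, hy, rfl⟩ := Submodule.mem_sup.1 ((hfV n).2 hw)
  obtain ⟨r, rfl⟩ := mem_span_left.1 hy
  refine (f m).add_mem ((hfV m).1 hv) ?_
  have : r ∈ leftColon (f n) x := ((f n).add_mem_iff_right ((hfV n).1 hv)).1 hw
  rw [← hn m hm] at this
  exact this

/-- Over a graded left Noetherian ring, the chain condition above `I` may be checked on cyclic
pieces. -/
theorem IsArtinianBetween.of_generators (hN : IsGradedLeftNoetherian 𝒜) {I B : Submodule R R}
    (hI : I.IsHomogeneous 𝒜) (X : Set R) (hB : B ≤ I ⊔ Submodule.span R X)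
    (hX : ∀ x ∈ X, SetLike.IsHomogeneousElem 𝒜 x ∧
      ∀ V, I ≤ V → IsArtinianBetween 𝒜 V (V ⊔ Submodule.span R {x})) :
    IsArtinianBetween 𝒜 I B := by
  obtain ⟨V, hV, ⟨hIV, hD⟩, hmax⟩ := exists_maximal_homogeneous hN
    (fun V => I ≤ V ∧ IsArtinianBetween 𝒜 I V) ⟨I, hI, le_rfl, isArtinianBetween_self I⟩
  refine hD.mono le_rfl (hB.trans (sup_le hIV (Submodule.span_le.2 fun x hx => ?_)))
  obtain ⟨⟨i, hxi⟩, hx'⟩ := hX x hx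
  exact hmax _ (isHomogeneous_sup hV (isHomogeneous_span_left hxi))
    ⟨hIV.trans le_sup_left, hD.trans (hx' V hIV) hV hIV le_sup_left⟩ le_sup_left
    (Submodule.mem_sup_right (Submodule.mem_span_singleton_self x))

theorem IsArtinianBetween.isGradedLeftArtinian (h : IsArtinianBetween 𝒜 (⊥ : Submodule R R) ⊤) :
    IsGradedLeftArtinian 𝒜 := by
  have : WellFoundedGT (GradedLeftIdeal 𝒜)ᵒᵈ := by
    refine wellFoundedGT_iff_monotone_chain_condition.2 fun f => ?_
    obtain ⟨n, hn⟩ := h (fun n => (OrderDual.ofDual (f n)).1) (fun m n hmn => f.monotone hmn)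
      (fun n => (OrderDual.ofDual (f n)).2) fun n => ⟨bot_le, le_top⟩
    exact ⟨n, fun m hm => Subtype.ext (hn m hm).symm⟩
  exact ⟨this.wf⟩

end ChainCondition

/-! ### From left Noetherian to left Artinian -/

section Hopkins

variable {G : Type v} [AddGroup G] [DecidableEq G] {R : Type u} [Ring R]
  {𝒜 : G → AddSubgroup R} [GradedRing 𝒜]

/-- If `x R` is a minimal graded right ideal modulo a graded-semiprime ideal `I`, then `R x` is a
minimal graded left ideal modulo `I`: left multiplications by elements `x s q` with `x s q x ∉ I`
are bijective on `x R` modulo `I`, and their inverses are again left multiplications. -/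
theorem left_minimal_of_right_minimal {I : Submodule R R} (hI : IsTwoSidedGraded 𝒜 I)
    (hsemi : ∀ i, ∀ a ∈ 𝒜 i, a ∉ I → ∃ r, SetLike.IsHomogeneousElem 𝒜 r ∧ a * r * a ∉ I)
    {i : G} {x : R} (hx : x ∈ 𝒜 i) (hxI : x ∉ I)
    (hmin : ∀ r, SetLike.IsHomogeneousElem 𝒜 r → x * r ∉ I → ∃ t, x = x * r * t)
    {q : R} (hq : SetLike.IsHomogeneousElem 𝒜 q) (hqx : q * x ∉ I) :
    ∃ c, x - c * (q * x) ∈ I := by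
  have hinj : ∀ y, SetLike.IsHomogeneousElem 𝒜 y → y * x ∉ I → ∀ r, y * x * r ∈ I →
      x * r ∈ I := by
    rintro y ⟨j, hy⟩ hyx r hr
    obtain ⟨s, hs⟩ := exists_sum_component 𝒜 r
    rw [← hs, Finset.mul_sum]
    refine sum_mem fun g _ => ?_
    by_contra hn
    obtain ⟨t, ht⟩ := hmin _ ⟨g, component_mem 𝒜 g r⟩ hn
    refine hyx ?_
    have h1 := hI.homogeneous (j + i + g) hr
    change component 𝒜 (j + i + g) (y * x * r) ∈ I at h1
    rw [component_mul_of_left_mem (mul_mem_degree hy hx)] at h1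
    have h2 := hI.mul_right _ h1 t
    rwa [mul_assoc, mul_assoc y, ← mul_assoc x, ← ht] at h2
  obtain ⟨j, hq⟩ := hq
  obtain ⟨s, ⟨k, hs⟩, hsI⟩ := hsemi _ _ (mul_mem_degree hq hx) hqx
  have hxs : x * s * q * x ∉ I := fun h => hsI (by
    have := left_mul_mem q h
    simpa only [mul_assoc] using this)
  obtain ⟨v, ⟨l, hv⟩, hvI⟩ := hsemi _ _ hx hxI
  obtain ⟨t, ht⟩ := hmin (s * q * x) ⟨_, mul_mem_degree (mul_mem_degree hs hq) hx⟩
    (by simpa only [mul_assoc] using hxs)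
  obtain ⟨u, hu⟩ := hmin (v * x) ⟨_, mul_mem_degree hv hx⟩ (by simpa only [mul_assoc] using hvI)
  -- `x u v` acts as the identity on `x`.
  have he : x * (u * v * x - 1) ∈ I := by
    refine hinj (x * v) ⟨_, mul_mem_degree hx hv⟩ hvI _ ?_
    have : x * v * x * (u * v * x - 1) = (x * (v * x) * u) * v * x - x * v * x := by noncomm_ring
    rw [this, ← hu, sub_self]
    exact I.zero_mem
  refine ⟨x * t * u * v * x * s, ?_⟩
  have h1 : x * (t * u * v * x * s * q * x - 1) ∈ I := by
    refine hinj (x * s * q) ⟨_, mul_mem_degree (mul_mem_degree hx hs) hq⟩ hxs _ ?_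
    have : x * s * q * x * (t * u * v * x * s * q * x - 1) =
        (x * (s * q * x) * t) * u * v * x * (s * q * x) - x * (s * q * x) := by noncomm_ring
    rw [this, ← ht]
    have h2 := hI.mul_right _ he (s * q * x)
    have h3 : x * (u * v * x - 1) * (s * q * x) =
      x * u * v * x * (s * q * x) - x * (s * q * x) := by noncomm_ring
    rwa [h3] at h2
  have h4 := I.neg_mem h1
  have h5 : -(x * (t * u * v * x * s * q * x - 1)) =
    x - x * t * u * v * x * s * (q * x) := by noncomm_ring
  rwa [h5] at h4

/-- A graded left Noetherian ring in which every set of homogeneous elements contains one whose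
right ideal is minimal is graded left Artinian. By Noetherian induction on graded two-sided ideals
`I`: if `R / I` is not semiprime, a nilpotent ideal splits off; otherwise a minimal right ideal
yields a minimal left ideal, and the two-sided ideal it generates has finite length on the
left. -/
theorem IsGradedLeftNoetherian.isGradedLeftArtinian (hN : IsGradedLeftNoetherian 𝒜)
    (hmin : ∀ C : Set R, C.Nonempty → (∀ x ∈ C, SetLike.IsHomogeneousElem 𝒜 x) →
      ∃ x ∈ C, ∀ r, SetLike.IsHomogeneousElem 𝒜 r → x * r ∈ C → ∃ t, x = x * r * t) :
    IsGradedLeftArtinian 𝒜 := by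
  refine IsArtinianBetween.isGradedLeftArtinian ?_
  by_contra hbot
  obtain ⟨I, -, ⟨hI, hID⟩, hmax⟩ := exists_maximal_homogeneous hN
    (fun I => IsTwoSidedGraded 𝒜 I ∧ ¬ IsArtinianBetween 𝒜 I ⊤)
    ⟨⊥, isHomogeneous_bot, ⟨isHomogeneous_bot, fun x hx r => by
      rw [(Submodule.mem_bot R).1 hx, zero_mul]; exact Submodule.zero_mem _⟩, hbot⟩
  have habove : ∀ B, IsTwoSidedGraded 𝒜 B → I ≤ B → ¬ B ≤ I → IsArtinianBetween 𝒜 B ⊤ := by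
    intro B hB hIB hBI
    by_contra hD
    exact hBI (hmax B hB.homogeneous ⟨hB, hD⟩ hIB)
  have hsemi : ∀ i, ∀ a ∈ 𝒜 i, a ∉ I → ∃ r, SetLike.IsHomogeneousElem 𝒜 r ∧ a * r * a ∉ I := by
    intro i a ha haI
    by_contra! hn
    have hB := isTwoSidedGraded_adjoinTwoSided hI ha
    have hIB : I ≤ adjoinTwoSided 𝒜 I a := le_sup_left
    have hBD := habove _ hB hIB fun h => haI (h (self_mem_adjoinTwoSided I a))
    refine hID (IsArtinianBetween.trans ?_ hBD hB.homogeneous hIB le_top)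
    refine IsArtinianBetween.of_generators hN hI.homogeneous _ le_rfl ?_
    rintro _ ⟨q, ⟨j, hq⟩, rfl⟩
    refine ⟨⟨_, mul_mem_degree ha hq⟩, fun V hV => ?_⟩
    exact hBD.sup_span (mul_mem_degree ha hq) fun r hr => hV
      (mul_mem_of_mem_adjoinTwoSided hI (mul_mul_mem_of_homogeneous hn) hr
        (mem_adjoinTwoSided I a q))
  have h1 : (1 : R) ∉ I := fun h1 => hID (by
    have : I = ⊤ := (Ideal.eq_top_iff_one I).2 h1
    rw [this]
    exact isArtinianBetween_self ⊤)
  obtain ⟨x, ⟨⟨i, hx⟩, hxI⟩, hxmin⟩ := hmin {x | SetLike.IsHomogeneousElem 𝒜 x ∧ x ∉ I}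
    ⟨1, ⟨0, SetLike.GradedOne.one_mem⟩, h1⟩ fun x hx => hx.1
  have hleft : ∀ q, SetLike.IsHomogeneousElem 𝒜 q → q * x ∉ I → ∃ c, x - c * (q * x) ∈ I :=
    fun q hq hqx => left_minimal_of_right_minimal hI hsemi hx hxI (fun r hr hxr => hxmin r hr
      ⟨by obtain ⟨j, hj⟩ := hr; exact ⟨_, mul_mem_degree hx hj⟩, hxr⟩) hq hqx
  -- The annihilator of `x` modulo `I` is a maximal graded left ideal.
  have hL : IsArtinianBetween 𝒜 (leftColon I x) ⊤ := by
    intro f hf hf' hfL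
    have hdich : ∀ n, ¬ f n ≤ leftColon I x → f n = ⊤ := by
      intro n hn
      have : ∃ g, ∃ r ∈ 𝒜 g, r ∈ f n ∧ r * x ∉ I := by
        by_contra! hall
        exact hn (le_of_homogeneous_mem (hf' n) fun g r hr hrn => hall g r hr hrn)
      obtain ⟨g, r, hr, hrn, hrx⟩ := this
      obtain ⟨c, hc⟩ := hleft r ⟨g, hr⟩ hrx
      have h2 : 1 - c * r ∈ f n := (hfL n).1 (by
        rw [mem_leftColon, sub_mul, one_mul, mul_assoc]
        exact hc)
      refine (Ideal.eq_top_iff_one (f n)).2 ?_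
      have h3 := (f n).add_mem h2 (left_mul_mem c hrn)
      rwa [sub_add_cancel] at h3
    by_cases hex : ∃ n, f n ≤ leftColon I x
    · obtain ⟨n, hn⟩ := hex
      refine ⟨n, fun m hm => le_antisymm (hf hm) (hn.trans (hfL m).1)⟩
    · rw [not_exists] at hex
      exact ⟨0, fun m _ => (hdich m (hex m)).trans (hdich 0 (hex 0)).symm⟩
  have hB := isTwoSidedGraded_adjoinTwoSided hI hx
  have hIB : I ≤ adjoinTwoSided 𝒜 I x := le_sup_left
  refine hID (IsArtinianBetween.trans ?_ (habove _ hB hIB fun h =>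
    hxI (h (self_mem_adjoinTwoSided I x))) hB.homogeneous hIB le_top)
  refine IsArtinianBetween.of_generators hN hI.homogeneous _ le_rfl ?_
  rintro _ ⟨q, ⟨j, hq⟩, rfl⟩
  refine ⟨⟨_, mul_mem_degree hx hq⟩, fun V hV => hL.sup_span (mul_mem_degree hx hq)
    fun r hr => hV ?_⟩
  rw [← mul_assoc]
  exact hI.mul_right _ hr q

theorem IsGradedLeftSelfInjective.isGradedLeftArtinian (hinj : IsGradedLeftSelfInjective 𝒜)
    (hN : IsGradedLeftNoetherian 𝒜) : IsGradedLeftArtinian 𝒜 := by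
  refine hN.isGradedLeftArtinian fun C ⟨x₀, hx₀⟩ hC => ?_
  have hann : ∀ x ∈ C, (leftColon (⊥ : Submodule R R) x).IsHomogeneous 𝒜 := fun x hx =>
    isHomogeneous_leftColon isHomogeneous_bot (hC x hx).choose_spec
  -- A maximal left annihilator belongs to a minimal principal right ideal.
  obtain ⟨_, -, ⟨x, hx, rfl⟩, hmax⟩ := exists_maximal_homogeneous hN
    (fun L => ∃ x ∈ C, leftColon ⊥ x = L) ⟨_, hann x₀ hx₀, x₀, hx₀, rfl⟩
  refine ⟨x, hx, fun r _ hxr => ?_⟩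
  obtain ⟨i, hi⟩ := hC x hx
  obtain ⟨j, hj⟩ := hC _ hxr
  refine hinj.exists_eq_mul hj hi fun s hs => ?_
  have h1 := hmax _ (hann _ hxr) ⟨_, hxr, rfl⟩ fun y hy => by
    rw [mem_leftColon_bot] at hy ⊢
    rw [← mul_assoc, hy, zero_mul]
  exact mem_leftColon_bot.1 (h1 (mem_leftColon_bot.2 hs))

end Hopkins

/-! ### Minimal graded two-sided ideals -/

section TwoSidedChain

variable {G : Type v} [AddGroup G] [DecidableEq G] {R : Type u} [Ring R]
  {𝒜 : G → AddSubgroup R} [GradedRing 𝒜]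

/-- A graded two-sided ideal as a right ideal. -/
def IsTwoSidedGraded.rightIdeal {I : Submodule R R} (hI : IsTwoSidedGraded 𝒜 I) :
    Submodule Rᵐᵒᵖ R where
  carrier := I
  add_mem' := I.add_mem
  zero_mem' := I.zero_mem
  smul_mem' c x hx := hI.mul_right x hx c.unop

theorem IsTwoSidedGraded.isHomogeneous_rightIdeal {I : Submodule R R}
    (hI : IsTwoSidedGraded 𝒜 I) : hI.rightIdeal.IsHomogeneous 𝒜 := hI.homogeneous

theorem IsTwoSidedGraded.leftAnn {I : Submodule R R} (hI : IsTwoSidedGraded 𝒜 I) :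
    IsTwoSidedGraded 𝒜 (leftAnn (I : Set R)) where
  homogeneous := isHomogeneous_leftAnn hI.isHomogeneous_rightIdeal
  mul_right r hr t s hs := by rw [mul_assoc]; exact hr _ (left_mul_mem t hs)

theorem RightDoubleAnnihilator.rightAnn_leftAnn (hr : RightDoubleAnnihilator 𝒜)
    {I : Submodule R R} (hI : IsTwoSidedGraded 𝒜 I) {x : R} :
    x ∈ rightAnn (leftAnn (I : Set R) : Set R) ↔ x ∈ I := by
  have := hr hI.rightIdeal hI.isHomogeneous_rightIdeal
  exact (SetLike.ext_iff.1 this x)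

/-- The left annihilator of a two-sided ideal is two-sided, so the ascending chain condition on
right ideals gives the descending chain condition on two-sided ideals. -/
theorem RightDoubleAnnihilator.exists_minimal_twoSided (hr : RightDoubleAnnihilator 𝒜)
    (hN : IsGradedRightNoetherian 𝒜) (p : Submodule R R → Prop)
    (hp : ∃ I, IsTwoSidedGraded 𝒜 I ∧ p I) :
    ∃ I, IsTwoSidedGraded 𝒜 I ∧ p I ∧ ∀ J, IsTwoSidedGraded 𝒜 J → p J → J ≤ I → I ≤ J := by
  obtain ⟨I₀, hI₀, hpI₀⟩ := hp
  obtain ⟨W, -, ⟨I, hI, hpI, hW⟩, hmax⟩ := exists_maximal_homogeneous hN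
    (fun W => ∃ I, IsTwoSidedGraded 𝒜 I ∧ p I ∧ (W : Set R) = leftAnn (I : Set R))
    ⟨hI₀.leftAnn.rightIdeal, hI₀.leftAnn.isHomogeneous_rightIdeal, I₀, hI₀, hpI₀, rfl⟩
  refine ⟨I, hI, hpI, fun J hJ hpJ hJI x hx => ?_⟩
  have hle : W ≤ hJ.leftAnn.rightIdeal := fun y hy => by
    have hy' : y ∈ leftAnn (I : Set R) := by
      have : y ∈ (W : Set R) := hy
      rwa [hW] at this
    exact leftAnn_anti (show (J : Set R) ⊆ I from hJI) hy'
  have h1 := hmax _ hJ.leftAnn.isHomogeneous_rightIdeal ⟨J, hJ, hpJ, rfl⟩ hle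
  rw [← hr.rightAnn_leftAnn hJ]
  refine rightAnn_anti (fun y hy => ?_) ((hr.rightAnn_leftAnn hI).2 hx)
  have : y ∈ (W : Set R) := h1 hy
  rwa [hW] at this

end TwoSidedChain

/-! ### The graded singular ideal and regularity -/

section Singular

variable {G : Type v} [AddGroup G] [DecidableEq G] {R : Type u} [Ring R]
  (𝒜 : G → AddSubgroup R) [GradedRing 𝒜]

/-- A graded left ideal meeting every nonzero graded left ideal. -/
structure IsGradedEssential (E : Submodule R R) : Prop where
  homogeneous : E.IsHomogeneous 𝒜
  eq_bot_of_inf_eq_bot : ∀ X : Submodule R R, X.IsHomogeneous 𝒜 → X ⊓ E = ⊥ → X = ⊥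

variable {𝒜}

theorem IsGradedEssential.inf {E F : Submodule R R} (hE : IsGradedEssential 𝒜 E)
    (hF : IsGradedEssential 𝒜 F) : IsGradedEssential 𝒜 (E ⊓ F) where
  homogeneous := isHomogeneous_inf hE.homogeneous hF.homogeneous
  eq_bot_of_inf_eq_bot X hX h := hE.eq_bot_of_inf_eq_bot X hX
    (hF.eq_bot_of_inf_eq_bot _ (isHomogeneous_inf hX hE.homogeneous) (by rw [inf_assoc, h]))

theorem IsGradedEssential.leftColon {E : Submodule R R} (hE : IsGradedEssential 𝒜 E) {i : G}
    {r : R} (hr : r ∈ 𝒜 i) : IsGradedEssential 𝒜 (leftColon E r) where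
  homogeneous := isHomogeneous_leftColon hE.homogeneous hr
  eq_bot_of_inf_eq_bot X hX h := by
    have hXr : X.map (LinearMap.toSpanSingleton R R r) = ⊥ := by
      refine hE.eq_bot_of_inf_eq_bot _ ?_ ((Submodule.eq_bot_iff _).2 ?_)
      · rintro g _ ⟨x, hx, rfl⟩
        exact ⟨_, hX (g - i) hx, (component_mul_of_right_mem' hr g x).symm⟩
      · rintro _ ⟨⟨x, hx, rfl⟩, hxE⟩
        have hx0 : x ∈ X ⊓ GradedQF.leftColon E r := ⟨hx, hxE⟩
        rw [h, Submodule.mem_bot] at hx0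
        rw [hx0, map_zero]
    rw [← h, left_eq_inf]
    intro x hx
    have hx0 : x * r ∈ X.map (LinearMap.toSpanSingleton R R r) := ⟨x, hx, rfl⟩
    rw [hXr, Submodule.mem_bot] at hx0
    rw [mem_leftColon, hx0]
    exact E.zero_mem

theorem isGradedEssential_top : IsGradedEssential 𝒜 (⊤ : Submodule R R) :=
  ⟨isHomogeneous_top, fun X _ h => by rwa [inf_top_eq] at h⟩

variable (𝒜) in
/-- The graded left singular ideal: the elements annihilated from the left by a graded essential
left ideal. -/
def singularIdeal : Submodule R R where
  carrier := {z | ∃ E, IsGradedEssential 𝒜 E ∧ ∀ e ∈ E, e * z = 0}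
  zero_mem' := ⟨⊤, isGradedEssential_top, fun e _ => mul_zero e⟩
  add_mem' := by
    rintro y z ⟨E, hE, hy⟩ ⟨F, hF, hz⟩
    exact ⟨E ⊓ F, hE.inf hF, fun e he => by rw [mul_add, hy e he.1, hz e he.2, add_zero]⟩
  smul_mem' := by
    intro r z hz
    have hadd : ∀ y y' : R, (∃ E, IsGradedEssential 𝒜 E ∧ ∀ e ∈ E, e * y = 0) →
        (∃ E, IsGradedEssential 𝒜 E ∧ ∀ e ∈ E, e * y' = 0) →
        ∃ E, IsGradedEssential 𝒜 E ∧ ∀ e ∈ E, e * (y + y') = 0 := by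
      rintro y z ⟨E, hE, hy⟩ ⟨F, hF, hz⟩
      exact ⟨E ⊓ F, hE.inf hF, fun e he => by rw [mul_add, hy e he.1, hz e he.2, add_zero]⟩
    obtain ⟨E, hE, hz⟩ := hz
    change ∃ E, IsGradedEssential 𝒜 E ∧ ∀ e ∈ E, e * (r * z) = 0
    induction r using Decomposition.inductionOn 𝒜 with
    | zero => exact ⟨⊤, isGradedEssential_top, fun e _ => by rw [zero_mul, mul_zero]⟩
    | homogeneous m =>
      exact ⟨_, hE.leftColon m.2, fun e he => by rw [← mul_assoc]; exact hz _ he⟩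
    | add r s hr hs => rw [add_mul]; exact hadd _ _ hr hs

theorem isTwoSidedGraded_singularIdeal : IsTwoSidedGraded 𝒜 (singularIdeal 𝒜) where
  homogeneous := by
    rintro g z ⟨E, hE, hz⟩
    refine ⟨E, hE, ?_⟩
    have : E ≤ leftColon ⊥ (component 𝒜 g z) := by
      refine le_of_homogeneous_mem hE.homogeneous fun k e he heE => ?_
      rw [mem_leftColon_bot, ← component_mul_of_left_mem he, hz e heE, map_zero]
    exact fun e he => mem_leftColon_bot.1 (this he)
  mul_right := by
    rintro z ⟨E, hE, hz⟩ r
    exact ⟨E, hE, fun e he => by rw [← mul_assoc, hz e he, zero_mul]⟩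

/-- Zorn's lemma for graded left ideals with a property `p` preserved by directed unions. -/
theorem exists_maximal_of_chain (p : Submodule R R → Prop) {U : Submodule R R}
    (hU : U.IsHomogeneous 𝒜) (hpU : p U)
    (hp : ∀ c : Set (Submodule R R), c.Nonempty → DirectedOn (· ≤ ·) c → (∀ V ∈ c, p V) →
      p (sSup c)) :
    ∃ L : Submodule R R, U ≤ L ∧ L.IsHomogeneous 𝒜 ∧ p L ∧
      ∀ V : Submodule R R, V.IsHomogeneous 𝒜 → p V → L ≤ V → V ≤ L := by
  obtain ⟨L, hUL, ⟨hL, hpL⟩, hmax⟩ := zorn_le_nonempty₀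
    {V : Submodule R R | V.IsHomogeneous 𝒜 ∧ p V} (fun c hcS hc V₀ hV₀ => by
      have hdir : DirectedOn (· ≤ ·) c := hc.directedOn
      refine ⟨sSup c, ⟨fun g x hx => ?_, hp c ⟨V₀, hV₀⟩ hdir fun V hV => (hcS hV).2⟩,
        fun _ => le_sSup⟩
      obtain ⟨V, hV, hxV⟩ := (Submodule.mem_sSup_of_directed ⟨V₀, hV₀⟩ hdir).1 hx
      exact (le_sSup hV : V ≤ _) ((hcS hV).1 g hxV)) U ⟨hU, hpU⟩
  exact ⟨L, hUL, hL, hpL, fun V hV hpV h => hmax ⟨hV, hpV⟩ h⟩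

/-- Every graded left ideal is a direct summand of a graded essential left ideal. -/
theorem exists_isGradedEssential_sup {N : Submodule R R} (hN : N.IsHomogeneous 𝒜) :
    ∃ K : Submodule R R, K.IsHomogeneous 𝒜 ∧ K ⊓ N = ⊥ ∧ IsGradedEssential 𝒜 (K ⊔ N) := by
  obtain ⟨K, -, hK, hKN, hmax⟩ := exists_maximal_of_chain (𝒜 := 𝒜) (fun K => K ⊓ N = ⊥)
    isHomogeneous_bot (bot_inf_eq N) (fun c hne hdir hc => by
      refine (Submodule.eq_bot_iff _).2 fun x hx => ?_
      obtain ⟨V, hV, hxV⟩ := (Submodule.mem_sSup_of_directed hne hdir).1 hx.1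
      have : x ∈ V ⊓ N := ⟨hxV, hx.2⟩
      rwa [hc V hV] at this)
  refine ⟨K, hK, hKN, isHomogeneous_sup hK hN, fun X hX h => ?_⟩
  have hXK : X ≤ K := le_sup_right.trans (hmax (K ⊔ X) (isHomogeneous_sup hK hX)
    ((Submodule.eq_bot_iff _).2 ?_) le_sup_left)
  · exact le_bot_iff.1 ((le_inf le_rfl (hXK.trans le_sup_left)).trans h.le)
  · rintro y ⟨hy, hyN⟩
    obtain ⟨k, hk, x, hx, rfl⟩ := Submodule.mem_sup.1 hy
    have hx0 : x ∈ X ⊓ (K ⊔ N) := ⟨hx, by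
      have := (K ⊔ N).sub_mem (Submodule.mem_sup_right hyN) (Submodule.mem_sup_left hk)
      rwa [add_sub_cancel_left] at this⟩
    rw [h, Submodule.mem_bot] at hx0
    subst hx0
    have : k + 0 ∈ K ⊓ N := ⟨by rwa [add_zero], hyN⟩
    rwa [hKN, Submodule.mem_bot] at this

/-- A graded left self-injective ring is graded von Neumann regular modulo its singular ideal. -/
theorem IsGradedLeftSelfInjective.exists_sub_mul_mul_mem (hinj : IsGradedLeftSelfInjective 𝒜)
    {i : G} {a : R} (ha : a ∈ 𝒜 i) :
    ∃ b ∈ 𝒜 (-i), a - a * b * a ∈ singularIdeal 𝒜 := by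
  obtain ⟨K, hK, hKN, hE⟩ := exists_isGradedEssential_sup
    (isHomogeneous_leftColon (𝒜 := 𝒜) (isHomogeneous_bot (S := R)) ha)
  -- Right multiplication by `a` is injective on `K`; extend its inverse.
  let Γ : Submodule R (R × R) :=
    K.map (LinearMap.prod (LinearMap.toSpanSingleton R R a) LinearMap.id)
  have hfun : ∀ y, ((0 : R), y) ∈ Γ → y = 0 := by
    rintro y ⟨k, hk, hky⟩
    obtain ⟨h1, rfl⟩ := Prod.mk.inj (hky : (k * a, k) = (0, y))
    have : k ∈ K ⊓ leftColon ⊥ a := ⟨hk, mem_leftColon_bot.2 h1⟩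
    rwa [hKN, Submodule.mem_bot] at this
  have hgr : ∀ p ∈ Γ, ∀ g, (component 𝒜 g p.1, component 𝒜 (g + -i) p.2) ∈ Γ := by
    rintro _ ⟨k, hk, rfl⟩ g
    refine ⟨component 𝒜 (g - i) k, hK _ hk, Prod.ext ?_ ?_⟩
    · exact (component_mul_of_right_mem' ha g k).symm
    · rw [← sub_eq_add_neg]; rfl
  obtain ⟨b, hb, hbΓ⟩ := hinj.exists_right_multiplier (-i) Γ hfun hgr
  refine ⟨b, hb, _, hE, fun e he => ?_⟩
  obtain ⟨k, hk, n, hn, rfl⟩ := Submodule.mem_sup.1 he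
  have h1 : k = k * a * b := hbΓ _ ⟨k, hk, rfl⟩
  have h2 : n * a = 0 := mem_leftColon_bot.1 hn
  have h3 : (k + n) * (a - a * b * a) = k * a - k * a * b * a + (n * a - n * a * b * a) := by
    noncomm_ring
  rw [h3, ← h1, h2]
  simp

theorem IsGradedLeftSelfInjective.exists_one_sub_mul_eq_one
    (hinj : IsGradedLeftSelfInjective 𝒜) {b : R} (hb : b ∈ 𝒜 0) (hbZ : b ∈ singularIdeal 𝒜) :
    ∃ c, (1 - b) * c = 1 := by
  obtain ⟨E, hE, hEb⟩ := hbZ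
  have h1 : (1 : R) ∈ 𝒜 0 := SetLike.GradedOne.one_mem
  have h1b : 1 - b ∈ 𝒜 0 := sub_mem h1 hb
  have hbot := hE.eq_bot_of_inf_eq_bot _
    (isHomogeneous_leftColon (isHomogeneous_bot (S := R)) h1b)
    ((Submodule.eq_bot_iff _).2 fun r hr => by
      have h2 : r * (1 - b) = 0 := mem_leftColon_bot.1 hr.1
      rwa [mul_sub, hEb r hr.2, mul_one, sub_zero] at h2)
  obtain ⟨c, hc⟩ := hinj.exists_eq_mul h1b h1 fun r hr => by
    have : r ∈ leftColon (⊥ : Submodule R R) (1 - b) := mem_leftColon_bot.2 hr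
    rw [hbot, Submodule.mem_bot] at this
    rw [this, zero_mul]
  exact ⟨c, hc.symm⟩

end Singular

/-! ### Graded prime ideals -/

section Prime

variable {G : Type v} [AddGroup G] [DecidableEq G] {R : Type u} [Ring R]
  (𝒜 : G → AddSubgroup R) [GradedRing 𝒜]

/-- Graded prime ideals of a graded ring, in terms of homogeneous elements. -/
structure IsGradedPrime (P : Submodule R R) : Prop extends IsTwoSidedGraded 𝒜 P where
  one_notMem : (1 : R) ∉ P
  mem_or_mem : ∀ {i j : G} {a b : R}, a ∈ 𝒜 i → b ∈ 𝒜 j → (∀ r, a * r * b ∈ P) → a ∈ P ∨ b ∈ P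

variable {𝒜}

theorem exists_homogeneous_of_not_le {S : Type*} [Semiring S] [Module S R] {U V : Submodule S R}
    (hU : U.IsHomogeneous 𝒜) (h : ¬ U ≤ V) : ∃ g, ∃ x ∈ 𝒜 g, x ∈ U ∧ x ∉ V := by
  by_contra! hn
  exact h (le_of_homogeneous_mem hU hn)

/-- The singular ideal is contained in every graded prime ideal. Otherwise let `C` be
minimal among the two-sided ideals contained in the singular ideal `Z` but not in `P`. As `P` is
prime, no proper two-sided subideal of `C` contains `C Z`, contrary to Nakayama's lemma. -/
theorem IsGradedPrime.singularIdeal_le (hinj : IsGradedLeftSelfInjective 𝒜)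
    (hN : IsGradedRightNoetherian 𝒜) {P : Submodule R R} (hP : IsGradedPrime 𝒜 P) :
    singularIdeal 𝒜 ≤ P := by
  by_contra hZP
  have hr := hinj.rightDoubleAnnihilator_of_isGradedRightNoetherian hN
  obtain ⟨C, hC, ⟨hCZ, hCP⟩, hmin⟩ := hr.exists_minimal_twoSided hN
    (fun C => C ≤ singularIdeal 𝒜 ∧ ¬ C ≤ P) ⟨_, isTwoSidedGraded_singularIdeal, le_rfl, hZP⟩
  obtain ⟨W, hW, ⟨hWC, hCW⟩, hmax⟩ := exists_maximal_homogeneous hN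
    (fun W => W ≤ hC.rightIdeal ∧ ¬ hC.rightIdeal ≤ W) ⟨⊥, isHomogeneous_bot, bot_le, fun h =>
      hCP fun x hx => by
        have hx0 : x ∈ (⊥ : Submodule Rᵐᵒᵖ R) := h hx
        rw [(Submodule.mem_bot _).1 hx0]
        exact P.zero_mem⟩
  -- Nakayama's lemma: the maximal subideal `W` of `C` contains `C Z`.
  have hprod : ∀ i j, ∀ x ∈ 𝒜 i, ∀ b ∈ 𝒜 j, x ∈ C → b ∈ singularIdeal 𝒜 → x * b ∈ W := by
    intro i j x hx b hb hxC hbZ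
    by_contra hxb
    have hxb' := mul_mem_degree hx hb
    have hCW' : hC.rightIdeal ≤ W ⊔ Submodule.span Rᵐᵒᵖ {x * b} := by
      by_contra hn
      exact hxb (hmax _ (isHomogeneous_sup hW (isHomogeneous_span_right hxb'))
        ⟨sup_le hWC ((Submodule.span_singleton_le_iff_mem _ _).2 (hC.mul_right x hxC b)), hn⟩
        le_sup_left (Submodule.mem_sup_right (Submodule.mem_span_singleton_self _)))
    obtain ⟨w, hw, y, hy, hwy⟩ := Submodule.mem_sup.1 (hCW' (show x ∈ hC.rightIdeal from hxC))
    obtain ⟨r, rfl⟩ := mem_span_right.1 hy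
    obtain ⟨t, ht, htW⟩ := exists_homogeneous_right_multiplier hW hxb' hx (r := r) (by
      rwa [← eq_sub_of_add_eq hwy])
    have hbt : b * t ∈ 𝒜 0 := by
      have := mul_mem_degree hb ht
      rwa [neg_add_rev, add_assoc, neg_add_cancel, add_zero, add_neg_cancel] at this
    obtain ⟨c, hc⟩ := hinj.exists_one_sub_mul_eq_one hbt
      (isTwoSidedGraded_singularIdeal.mul_right b hbZ t)
    have hxW : x ∈ W := by
      have h1 := right_mul_mem htW c
      rwa [show (x - x * b * t) * c = x * ((1 - b * t) * c) by noncomm_ring, hc, mul_one] at h1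
    exact hxb (right_mul_mem hxW b)
  have hprod' : ∀ j, ∀ x ∈ C, ∀ b ∈ 𝒜 j, b ∈ singularIdeal 𝒜 → x * b ∈ W := by
    intro j x hx b hb hbZ
    obtain ⟨s, hs⟩ := exists_sum_component 𝒜 x
    rw [← hs, Finset.sum_mul]
    exact sum_mem fun g _ => hprod g j _ (component_mem 𝒜 g x) b hb (hC.homogeneous g hx) hbZ
  -- The largest two-sided ideal inside `W`.
  let D : Submodule R R :=
    { carrier := {x | x ∈ C ∧ ∀ r, r * x ∈ W}
      zero_mem' := ⟨C.zero_mem, fun r => by rw [mul_zero]; exact W.zero_mem⟩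
      add_mem' := fun hx hy => ⟨C.add_mem hx.1 hy.1, fun r => by
        rw [mul_add]; exact W.add_mem (hx.2 r) (hy.2 r)⟩
      smul_mem' := fun s x hx => ⟨C.smul_mem s hx.1, fun r => by
        rw [smul_eq_mul, ← mul_assoc]; exact hx.2 (r * s)⟩ }
  have hD : IsTwoSidedGraded 𝒜 D := by
    refine ⟨fun g x hx => ⟨hC.homogeneous g hx.1, fun r => ?_⟩, fun x hx t =>
      ⟨hC.mul_right x hx.1 t, fun r => ?_⟩⟩
    · obtain ⟨s, hs⟩ := exists_sum_component 𝒜 r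
      rw [← hs, Finset.sum_mul]
      refine sum_mem fun k _ => ?_
      have := hW (k + g) (hx.2 (component 𝒜 k r))
      change component 𝒜 (k + g) (component 𝒜 k r * x) ∈ W at this
      rwa [component_mul_of_left_mem (component_mem 𝒜 k r)] at this
    · rw [← mul_assoc]
      exact right_mul_mem (hx.2 r) t
  have hDC : D ≤ C := fun x hx => hx.1
  have hDP : D ≤ P := by
    by_contra hDP
    refine hCW fun x hx => ?_
    have := (hmin D hD ⟨hDC.trans hCZ, hDP⟩ hDC hx).2 1
    rwa [one_mul] at this
  obtain ⟨i, c, hc, hcC, hcP⟩ := exists_homogeneous_of_not_le hC.homogeneous hCP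
  obtain ⟨j, z, hz, hzZ, hzP⟩ := exists_homogeneous_of_not_le
    isTwoSidedGraded_singularIdeal.homogeneous hZP
  refine (hP.mem_or_mem hc hz fun r =>
    hDP ⟨hC.mul_right _ (hC.mul_right c hcC r) z, fun s => ?_⟩).elim hcP hzP
  rw [← mul_assoc]
  exact hprod' j _ (left_mul_mem s (hC.mul_right c hcC r)) z hz hzZ

/-- Graded von Neumann regularity of `R / P`: every homogeneous `a` is congruent to some `a b a`
with `b` homogeneous of the opposite degree. -/
def IsRegularModulo (𝒜 : G → AddSubgroup R) (P : Submodule R R) : Prop :=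
  ∀ i, ∀ a ∈ 𝒜 i, ∃ b ∈ 𝒜 (-i), a - a * b * a ∈ P

theorem IsGradedPrime.isRegularModulo (hinj : IsGradedLeftSelfInjective 𝒜)
    (hN : IsGradedRightNoetherian 𝒜) {P : Submodule R R} (hP : IsGradedPrime 𝒜 P) :
    IsRegularModulo 𝒜 P := fun i a ha => by
  obtain ⟨b, hb, hab⟩ := hinj.exists_sub_mul_mul_mem ha
  exact ⟨b, hb, hP.singularIdeal_le hinj hN hab⟩

/-- In a graded right Noetherian von Neumann regular ring every graded right ideal is generated by
an idempotent of degree zero. -/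
theorem IsRegularModulo.exists_left_identity (hN : IsGradedRightNoetherian 𝒜)
    {P : Submodule R R} (hP : IsTwoSidedGraded 𝒜 P) (hreg : IsRegularModulo 𝒜 P)
    {A : Submodule Rᵐᵒᵖ R} (hA : A.IsHomogeneous 𝒜) :
    ∃ f ∈ 𝒜 0, f ∈ A ∧ ∀ x ∈ A, x - f * x ∈ P := by
  obtain ⟨B, hB, ⟨f, hf, hfA, hfB⟩, hmax⟩ := exists_maximal_homogeneous hN
    (fun B => ∃ f ∈ 𝒜 0, f ∈ A ∧ ∀ x ∈ B, x - f * x ∈ P)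
    ⟨⊥, isHomogeneous_bot, 0, zero_mem _, A.zero_mem, fun x hx => by
      rw [(Submodule.mem_bot _).1 hx, mul_zero, sub_zero]
      exact P.zero_mem⟩
  suffices h : A ≤ B from ⟨f, hf, hfA, fun x hx => hfB x (h hx)⟩
  refine le_of_homogeneous_mem hA fun i a ha haA => ?_
  have hfa : a - f * a ∈ 𝒜 i := sub_mem ha (by simpa using mul_mem_degree hf ha)
  have hfaA : a - f * a ∈ A := A.sub_mem haA (right_mul_mem hfA a)
  obtain ⟨d, hd, hdP⟩ := hreg i _ hfa
  have hg : (a - f * a) * d ∈ 𝒜 0 := by simpa using mul_mem_degree hfa hd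
  have hgA := right_mul_mem hfaA d
  generalize (a - f * a) * d = g at hdP hg hgA
  refine hmax (B ⊔ Submodule.span Rᵐᵒᵖ {a}) (isHomogeneous_sup hB (isHomogeneous_span_right ha))
    ⟨f + g - g * f, sub_mem (add_mem hf hg) (by simpa using mul_mem_degree hg hf),
      A.sub_mem (A.add_mem hfA hgA) (right_mul_mem hgA f), fun x hx => ?_⟩ le_sup_left
    (Submodule.mem_sup_right (Submodule.mem_span_singleton_self a))
  obtain ⟨y, hy, z, hz, rfl⟩ := Submodule.mem_sup.1 hx
  obtain ⟨r, rfl⟩ := mem_span_right.1 hz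
  have h1 : y + a * r - (f + g - g * f) * (y + a * r) =
      (y - f * y) - g * (y - f * y) + (a - f * a - g * (a - f * a)) * r := by noncomm_ring
  rw [h1]
  exact P.add_mem (P.sub_mem (hfB y hy) (left_mul_mem g (hfB y hy))) (hP.mul_right _ hdP r)

theorem IsGradedPrime.eq_of_le (hN : IsGradedRightNoetherian 𝒜) {P B : Submodule R R}
    (hP : IsGradedPrime 𝒜 P) (hreg : IsRegularModulo 𝒜 P) (hB : IsTwoSidedGraded 𝒜 B)
    (h1 : (1 : R) ∉ B) (hPB : P ≤ B) : P = B := by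
  refine le_antisymm hPB ?_
  by_contra hBP
  obtain ⟨i, b, hb, hbB, hbP⟩ := exists_homogeneous_of_not_le hB.homogeneous hBP
  obtain ⟨f, hf, hfB, hfx⟩ := hreg.exists_left_identity hN hP.toIsTwoSidedGraded
    hB.isHomogeneous_rightIdeal
  have h2 : (1 : R) - f ∈ P := (hP.mem_or_mem (sub_mem SetLike.GradedOne.one_mem hf) hb fun r => by
    have := hfx (r * b) (left_mul_mem r hbB)
    rwa [mul_assoc, sub_mul, one_mul]).resolve_right hbP
  refine h1 ?_
  have := B.add_mem (hPB h2) hfB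
  rwa [sub_add_cancel] at this

/-- Modulo a prime ideal with regular quotient there is a minimal graded left ideal, generated by
an element of degree zero: the complement of a maximal graded right ideal is generated by an
idempotent `k`, and `R k` is also minimal. -/
theorem IsGradedPrime.exists_minimal_left (hN : IsGradedRightNoetherian 𝒜) {P : Submodule R R}
    (hP : IsGradedPrime 𝒜 P) (hreg : IsRegularModulo 𝒜 P) :
    ∃ k ∈ 𝒜 0, k ∉ P ∧ ∀ q, SetLike.IsHomogeneousElem 𝒜 q → q * k ∉ P →
      ∃ c, k - c * (q * k) ∈ P := by
  obtain ⟨M, hM, ⟨hPM, h1M⟩, hmax⟩ := exists_maximal_homogeneous hN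
    (fun M => hP.rightIdeal ≤ M ∧ (1 : R) ∉ M)
    ⟨hP.rightIdeal, hP.isHomogeneous_rightIdeal, le_rfl, hP.one_notMem⟩
  obtain ⟨f, hf, hfM, hfx⟩ := hreg.exists_left_identity hN hP.toIsTwoSidedGraded hM
  have h1 : (1 : R) ∈ 𝒜 0 := SetLike.GradedOne.one_mem
  refine ⟨1 - f, sub_mem h1 hf, fun hk => h1M ?_, ?_⟩
  · have := M.add_mem (hPM hk) hfM
    rwa [sub_add_cancel] at this
  · rintro q ⟨j, hq⟩ hqk
    have hqk' : q * (1 - f) ∈ 𝒜 j := by simpa using mul_mem_degree hq (sub_mem h1 hf)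
    obtain ⟨b, hb, hbP⟩ := hreg j _ hqk'
    -- The right annihilator of `q k` modulo `P` is `M`.
    let N : Submodule Rᵐᵒᵖ R :=
      { carrier := {r | q * (1 - f) * r ∈ P}
        zero_mem' := by simp
        add_mem' := fun hx hy => by
          change _ ∈ P
          rw [mul_add]
          exact P.add_mem hx hy
        smul_mem' := fun c x hx => by
          change _ * (x * c.unop) ∈ P
          rw [← mul_assoc]
          exact hP.mul_right _ hx _ }
    have hNhom : N.IsHomogeneous 𝒜 := fun g r hr => by
      have := hP.homogeneous (j + g) (show q * (1 - f) * r ∈ P from hr)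
      change component 𝒜 (j + g) (q * (1 - f) * r) ∈ P at this
      rwa [component_mul_of_left_mem hqk'] at this
    have hMN : M ≤ N := fun x hx => by
      change q * (1 - f) * x ∈ P
      rw [mul_assoc, sub_mul, one_mul]
      exact left_mul_mem q (hfx x hx)
    have h1N : (1 : R) ∉ N := fun h => hqk (by
      change q * (1 - f) * 1 ∈ P at h
      rwa [mul_one] at h)
    have hwN : 1 - b * (q * (1 - f)) ∈ N := by
      change q * (1 - f) * (1 - b * (q * (1 - f))) ∈ P
      rwa [mul_sub, mul_one, ← mul_assoc]
    have hwM := hmax N hNhom ⟨hPM.trans hMN, h1N⟩ hMN hwN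
    have h2 := hfx _ hwM
    refine ⟨(1 - f) * b, ?_⟩
    have h3 : 1 - b * (q * (1 - f)) - f * (1 - b * (q * (1 - f))) =
      1 - f - (1 - f) * b * (q * (1 - f)) := by noncomm_ring
    rwa [h3] at h2

theorem IsGradedPrime.exists_le_of_forall_mem {P : Submodule R R} (hP : IsGradedPrime 𝒜 P)
    (F : Finset (Submodule R R)) (hF : ∀ Q ∈ F, IsTwoSidedGraded 𝒜 Q)
    (h : ∀ x, (∀ Q ∈ F, x ∈ Q) → x ∈ P) : ∃ Q ∈ F, Q ≤ P := by
  classical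
  by_contra! hn
  suffices ∃ i, ∃ a ∈ 𝒜 i, a ∉ P ∧ ∀ Q ∈ F, a ∈ Q by
    obtain ⟨i, a, -, haP, haF⟩ := this
    exact haP (h a haF)
  clear h
  induction F using Finset.induction_on with
  | empty => exact ⟨0, 1, SetLike.GradedOne.one_mem, hP.one_notMem, by simp⟩
  | insert Q F _ ih =>
    obtain ⟨i, a, ha, haP, haF⟩ := ih (fun Q' h => hF Q' (Finset.mem_insert_of_mem h))
      fun Q' h => hn Q' (Finset.mem_insert_of_mem h)
    obtain ⟨j, q, hq, hqQ, hqP⟩ := exists_homogeneous_of_not_le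
      (hF Q (Finset.mem_insert_self Q F)).homogeneous (hn Q (Finset.mem_insert_self Q F))
    have : ∃ r, SetLike.IsHomogeneousElem 𝒜 r ∧ a * r * q ∉ P := by
      by_contra! hall
      exact (hP.mem_or_mem ha hq (mul_mul_mem_of_homogeneous hall)).elim haP hqP
    obtain ⟨r, ⟨k, hr⟩, hrP⟩ := this
    refine ⟨_, _, mul_mem_degree (mul_mem_degree ha hr) hq, hrP, fun Q' hQ' => ?_⟩
    rcases Finset.mem_insert.1 hQ' with rfl | hQ'
    · exact left_mul_mem _ hqQ
    · have := hF Q' (Finset.mem_insert_of_mem hQ')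
      exact this.mul_right _ (this.mul_right _ (haF Q' hQ') _) _

/-- A graded left self-injective and right Noetherian ring has finitely many graded prime
ideals, all of them maximal. -/
theorem IsGradedLeftSelfInjective.finite_primes (hinj : IsGradedLeftSelfInjective 𝒜)
    (hN : IsGradedRightNoetherian 𝒜) : Finite {P : Submodule R R // IsGradedPrime 𝒜 P} := by
  classical
  have hr := hinj.rightDoubleAnnihilator_of_isGradedRightNoetherian hN
  obtain ⟨J, hJ, ⟨F, hF, hJF⟩, hmin⟩ := hr.exists_minimal_twoSided hN
    (fun J => ∃ F : Finset (Submodule R R), (∀ Q ∈ F, IsGradedPrime 𝒜 Q) ∧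
      ∀ x, x ∈ J ↔ ∀ Q ∈ F, x ∈ Q)
    ⟨⊤, ⟨isHomogeneous_top, fun _ _ _ => Submodule.mem_top⟩, ∅, by simp, by simp⟩
  refine Finite.of_injective (β := F) (fun P => ⟨P.1, ?_⟩) fun P Q h => Subtype.ext
    (Subtype.mk.inj h)
  obtain ⟨P, hP⟩ := P
  have hle : J ≤ J ⊓ P := hmin (J ⊓ P)
    ⟨isHomogeneous_inf hJ.homogeneous hP.homogeneous,
      fun x hx r => ⟨hJ.mul_right x hx.1 r, hP.mul_right x hx.2 r⟩⟩
    ⟨insert P F, by simpa using ⟨hP, hF⟩, fun x => by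
      simp [hJF x, and_comm]⟩ inf_le_left
  obtain ⟨Q, hQ, hQP⟩ := hP.exists_le_of_forall_mem F (fun Q h => (hF Q h).toIsTwoSidedGraded)
    fun x hx => (hle ((hJF x).2 hx)).2
  have := (hF Q hQ).eq_of_le hN ((hF Q hQ).isRegularModulo hinj hN) hP.toIsTwoSidedGraded
    hP.one_notMem hQP
  exact this ▸ hQ

end Prime

/-! ### Embedding graded simple modules -/

section Socle

variable {G : Type v} [AddGroup G] [DecidableEq G] {R : Type u} [Ring R]
  {𝒜 : G → AddSubgroup R} [GradedRing 𝒜]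

/-- The annihilator of the left module `R / L`: the largest two-sided ideal contained in `L`. -/
def leftCore (L : Submodule R R) : Submodule R R where
  carrier := {r | ∀ s, r * s ∈ L}
  zero_mem' s := by rw [zero_mul]; exact L.zero_mem
  add_mem' ha hb s := by rw [add_mul]; exact L.add_mem (ha s) (hb s)
  smul_mem' c r hr s := by rw [smul_eq_mul, mul_assoc]; exact left_mul_mem c (hr s)

theorem leftCore_le (L : Submodule R R) : leftCore L ≤ L := fun r hr => by simpa using hr 1

theorem isTwoSidedGraded_leftCore {L : Submodule R R} (hL : L.IsHomogeneous 𝒜) :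
    IsTwoSidedGraded 𝒜 (leftCore L) where
  homogeneous g r hr s := by
    change component 𝒜 g r * s ∈ L
    obtain ⟨t, ht⟩ := exists_sum_component 𝒜 s
    rw [← ht, Finset.mul_sum]
    refine sum_mem fun k _ => ?_
    rw [← component_mul_of_right_mem (component_mem 𝒜 k s)]
    exact hL _ (hr _)
  mul_right r hr t s := by rw [mul_assoc]; exact hr _

/-- If `R / P` has a minimal left ideal `R k` modulo the annihilator `P` of `R / L`, then that
minimal left ideal embeds into `R / L`. -/
theorem exists_mul_mem_iff_mem_leftCore {L : Submodule R R} (hL : L.IsHomogeneous 𝒜) {i : G}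
    {k : R} (hk : k ∈ 𝒜 i) (hkL : k ∉ leftCore L)
    (hmin : ∀ q, SetLike.IsHomogeneousElem 𝒜 q → q * k ∉ leftCore L →
      ∃ c, k - c * (q * k) ∈ leftCore L) :
    ∃ s, SetLike.IsHomogeneousElem 𝒜 s ∧ k * s ∉ L ∧
      ∀ u, u * (k * s) ∈ L ↔ u * k ∈ leftCore L := by
  have : ∃ s, SetLike.IsHomogeneousElem 𝒜 s ∧ k * s ∉ L := by
    by_contra! hn
    refine hkL fun s => ?_
    obtain ⟨t, ht⟩ := exists_sum_component 𝒜 s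
    rw [← ht, Finset.mul_sum]
    exact sum_mem fun g _ => hn _ ⟨g, component_mem 𝒜 g s⟩
  obtain ⟨s, ⟨j, hs⟩, hksL⟩ := this
  have hle : leftColon L (k * s) ≤ leftColon (leftCore L) k := by
    refine le_of_homogeneous_mem (isHomogeneous_leftColon hL (mul_mem_degree hk hs))
      fun g u hu huL => ?_
    by_contra huk
    obtain ⟨c, hc⟩ := hmin u ⟨g, hu⟩ huk
    refine hksL ?_
    have h1 := L.add_mem (hc s) (left_mul_mem c (mem_leftColon.1 huL))
    rwa [sub_mul, mul_assoc c, mul_assoc u, sub_add_cancel] at h1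
  refine ⟨s, ⟨j, hs⟩, hksL, fun u => ⟨fun h => hle h, fun h => ?_⟩⟩
  rw [← mul_assoc]
  exact h s

/-- Every graded prime ideal `P` annihilates from the right a homogeneous `y ≠ 0` such that the
left annihilator of `R y` is again prime: choose `y` with the largest such annihilator. That `y` is
nonzero is part of the annihilator being proper. -/
theorem IsGradedPrime.exists_annihilated (hr : RightDoubleAnnihilator 𝒜)
    (hN : IsGradedRightNoetherian 𝒜) {P : Submodule R R} (hP : IsGradedPrime 𝒜 P) :
    ∃ i, ∃ y ∈ 𝒜 i, y ∈ leftAnn (P : Set R) ∧ IsGradedPrime 𝒜 (leftCore (leftColon ⊥ y)) := by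
  have hcore : ∀ {i : G} {y : R}, y ∈ 𝒜 i → IsTwoSidedGraded 𝒜 (leftCore (leftColon ⊥ y)) :=
    fun hy => isTwoSidedGraded_leftCore (isHomogeneous_leftColon isHomogeneous_bot hy)
  have hbot : ¬ leftAnn (P : Set R) ≤ ⊥ := fun h => hP.one_notMem (by
    rw [← hr.rightAnn_leftAnn hP.toIsTwoSidedGraded]
    intro s hs
    rw [(Submodule.mem_bot R).1 (h hs), zero_mul])
  obtain ⟨i₀, y₀, hy₀, hy₀P, hy₀0⟩ :=
    exists_homogeneous_of_not_le hP.toIsTwoSidedGraded.leftAnn.homogeneous hbot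
  obtain ⟨W, -, ⟨i, y, hy, hyP, hy0, hyW⟩, hmax⟩ := exists_maximal_homogeneous hN
    (fun W => ∃ i, ∃ y ∈ 𝒜 i, y ∈ leftAnn (P : Set R) ∧ y ≠ 0 ∧
      (W : Set R) = leftCore (leftColon ⊥ y))
    ⟨(hcore hy₀).rightIdeal, (hcore hy₀).isHomogeneous_rightIdeal, i₀, y₀, hy₀, hy₀P,
      by simpa using hy₀0, rfl⟩
  refine ⟨i, y, hy, hyP, hcore hy, fun h => ?_, fun {j l a b} ha hb hab => ?_⟩
  · refine hy0 ?_
    simpa using mem_leftColon_bot.1 (h 1)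
  · -- If `b` does not annihilate `R y`, then some `b s y` has the same annihilator as `y`.
    refine or_iff_not_imp_right.2 fun hbI => ?_
    have : ∃ s, SetLike.IsHomogeneousElem 𝒜 s ∧ b * s * y ≠ 0 := by
      by_contra! hn
      refine hbI fun s => mem_leftColon_bot.2 ?_
      obtain ⟨t, ht⟩ := exists_sum_component 𝒜 s
      rw [← ht, Finset.mul_sum, Finset.sum_mul]
      exact Finset.sum_eq_zero fun g _ => hn _ ⟨g, component_mem 𝒜 g s⟩
    obtain ⟨s, ⟨m, hs⟩, hbs⟩ := this
    have hbsy := mul_mem_degree (mul_mem_degree hb hs) hy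
    have hle : W ≤ (hcore hbsy).rightIdeal := fun r hr t => by
      have hr' : r ∈ (W : Set R) := hr
      rw [hyW] at hr'
      have := mem_leftColon_bot.1 (hr' (t * (b * s)))
      rw [mem_leftColon_bot, mul_assoc r, ← mul_assoc t, ← mul_assoc r]
      exact this
    have ha' : a ∈ (hcore hbsy).rightIdeal := fun t => by
      have := mem_leftColon_bot.1 (hab t s)
      rw [mem_leftColon_bot]
      simpa only [mul_assoc] using this
    have haW : a ∈ (W : Set R) := hmax _ (hcore hbsy).isHomogeneous_rightIdeal
      ⟨_, _, hbsy, left_mul_mem _ hyP, hbs, rfl⟩ hle ha'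
    rwa [hyW] at haW

/-- The core of a maximal graded left ideal is prime. -/
theorem isGradedPrime_leftCore {L : Submodule R R} (hL : L.IsHomogeneous 𝒜) (h1 : (1 : R) ∉ L)
    (hmax : ∀ V : Submodule R R, V.IsHomogeneous 𝒜 → (1 : R) ∉ V → L ≤ V → V ≤ L) :
    IsGradedPrime 𝒜 (leftCore L) := by
  refine ⟨isTwoSidedGraded_leftCore hL, fun h => h1 (leftCore_le L h),
    fun {i j a b} ha hb hab => or_iff_not_imp_right.2 fun hbI t => ?_⟩
  have : ∃ s, SetLike.IsHomogeneousElem 𝒜 s ∧ b * s ∉ L := by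
    by_contra! hn
    refine hbI fun s => ?_
    obtain ⟨t, ht⟩ := exists_sum_component 𝒜 s
    rw [← ht, Finset.mul_sum]
    exact sum_mem fun g _ => hn _ ⟨g, component_mem 𝒜 g s⟩
  obtain ⟨s, ⟨k, hs⟩, hbs⟩ := this
  have h1' : (1 : R) ∈ L ⊔ Submodule.span R {b * s} := by
    by_contra hn
    exact hbs (hmax _ (isHomogeneous_sup hL (isHomogeneous_span_left (mul_mem_degree hb hs))) hn
      le_sup_left (Submodule.mem_sup_right (Submodule.mem_span_singleton_self _)))
  obtain ⟨l, hl, y, hy, hly⟩ := Submodule.mem_sup.1 h1'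
  obtain ⟨r, rfl⟩ := mem_span_left.1 hy
  have h2 : a * t = a * t * l + a * (t * r) * b * s := by
    calc a * t = a * t * (l + r * (b * s)) := by rw [hly, mul_one]
      _ = _ := by noncomm_ring
  rw [h2]
  exact L.add_mem (left_mul_mem _ hl) (hab (t * r) s)

/-- If `R x` and `R y` have the same prime annihilator, both contain a copy of the same minimal
left ideal, so nonzero multiples of `x` and `y` have equal left annihilators and the multiple of
`y` is a right multiple of that of `x`. Hence `x` and `y` are not annihilated from the right by
distinct, and therefore comaximal, primes. -/
theorem IsGradedPrime.eq_of_leftCore_eq (hinj : IsGradedLeftSelfInjective 𝒜)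
    (hN : IsGradedRightNoetherian 𝒜) {P Q : Submodule R R} (hP : IsGradedPrime 𝒜 P)
    (hQ : IsGradedPrime 𝒜 Q) {i j : G} {x y : R} (hx : x ∈ 𝒜 i) (hy : y ∈ 𝒜 j)
    (hxP : x ∈ leftAnn (P : Set R)) (hyQ : y ∈ leftAnn (Q : Set R))
    (hI : IsGradedPrime 𝒜 (leftCore (leftColon ⊥ x)))
    (hxy : leftCore (leftColon ⊥ x) = leftCore (leftColon ⊥ y)) : P = Q := by
  obtain ⟨k, hk, hkI, hkmin⟩ := hI.exists_minimal_left hN (hI.isRegularModulo hinj hN)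
  obtain ⟨s, ⟨m, hs⟩, -, hsu⟩ := exists_mul_mem_iff_mem_leftCore
    (isHomogeneous_leftColon isHomogeneous_bot hx) hk hkI hkmin
  rw [hxy] at hkI hkmin
  obtain ⟨t, ⟨n, ht⟩, ht0, htu⟩ := exists_mul_mem_iff_mem_leftCore
    (isHomogeneous_leftColon isHomogeneous_bot hy) hk hkI hkmin
  simp only [mem_leftColon_bot] at hsu ht0 htu
  obtain ⟨c, hc⟩ := hinj.exists_eq_mul (mul_mem_degree (mul_mem_degree hk hs) hx)
    (mul_mem_degree (mul_mem_degree hk ht) hy) fun r hr => by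
      rw [← mul_assoc] at hr ⊢
      rw [htu, ← hxy, ← hsu, hr]
  have hzQ : k * t * y ∈ leftAnn (Q : Set R) := left_mul_mem _ hyQ
  have hzP : k * t * y ∈ leftAnn (P : Set R) := fun p hp => by
    rw [hc, mul_assoc, mul_assoc, hxP _ (left_mul_mem c hp), mul_zero]
  have h1 : (1 : R) ∉ P ⊔ Q := fun h => ht0 (by
    obtain ⟨p, hp, q, hq, hpq⟩ := Submodule.mem_sup.1 h
    rw [← mul_one (k * t * y), ← hpq, mul_add, hzP p hp, hzQ q hq, add_zero])
  have hPQ : IsTwoSidedGraded 𝒜 (P ⊔ Q) :=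
    ⟨isHomogeneous_sup hP.homogeneous hQ.homogeneous, fun z hz r => by
      obtain ⟨p, hp, q, hq, rfl⟩ := Submodule.mem_sup.1 hz
      rw [add_mul]
      exact Submodule.add_mem_sup (hP.mul_right p hp r) (hQ.mul_right q hq r)⟩
  rw [hP.eq_of_le hN (hP.isRegularModulo hinj hN) hPQ h1 le_sup_left]
  exact (hQ.eq_of_le hN (hQ.isRegularModulo hinj hN) hPQ h1 le_sup_right).symm

/-- Every graded prime ideal is the left annihilator of some `R y` with `y` homogeneous: sending
`P` to the annihilator of `R y`, where `y P = 0`, is an injective self-map of the finite set of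
graded primes. -/
theorem IsGradedPrime.exists_eq_leftCore (hinj : IsGradedLeftSelfInjective 𝒜)
    (hN : IsGradedRightNoetherian 𝒜) {P : Submodule R R} (hP : IsGradedPrime 𝒜 P) :
    ∃ i, ∃ y ∈ 𝒜 i, leftCore (leftColon ⊥ y) = P := by
  have hr := hinj.rightDoubleAnnihilator_of_isGradedRightNoetherian hN
  have := hinj.finite_primes hN
  choose i y hy hyP hprime using fun P : {P : Submodule R R // IsGradedPrime 𝒜 P} =>
    P.2.exists_annihilated hr hN
  let φ : {P : Submodule R R // IsGradedPrime 𝒜 P} → {P : Submodule R R // IsGradedPrime 𝒜 P} :=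
    fun P => ⟨_, hprime P⟩
  have hφ : Function.Injective φ := fun P Q h => Subtype.ext
    (P.2.eq_of_leftCore_eq hinj hN Q.2 (hy P) (hy Q) (hyP P) (hyP Q) (hprime P) (Subtype.mk.inj h))
  obtain ⟨Q, hQ⟩ := Finite.surjective_of_injective hφ ⟨P, hP⟩
  exact ⟨i Q, y Q, hy Q, congrArg Subtype.val hQ⟩

/-- Every graded simple left module embeds into `R` up to a shift. -/
theorem IsGradedLeftSelfInjective.exists_annihilated_by_maximal
    (hinj : IsGradedLeftSelfInjective 𝒜) (hN : IsGradedRightNoetherian 𝒜) {L : Submodule R R}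
    (hL : L.IsHomogeneous 𝒜) (h1 : (1 : R) ∉ L)
    (hmax : ∀ V : Submodule R R, V.IsHomogeneous 𝒜 → (1 : R) ∉ V → L ≤ V → V ≤ L) :
    ∃ i, ∃ z ∈ 𝒜 i, z ≠ 0 ∧ ∀ l ∈ L, l * z = 0 := by
  have hP := isGradedPrime_leftCore hL h1 hmax
  obtain ⟨i, x, hx, hxL⟩ := hP.exists_eq_leftCore hinj hN
  obtain ⟨k, hk, hkI, hkmin⟩ := hP.exists_minimal_left hN (hP.isRegularModulo hinj hN)
  obtain ⟨s, ⟨m, hs⟩, hksL, hsu⟩ := exists_mul_mem_iff_mem_leftCore hL hk hkI hkmin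
  rw [← hxL] at hkI hkmin
  obtain ⟨t, ⟨n, ht⟩, -, htu⟩ := exists_mul_mem_iff_mem_leftCore
    (isHomogeneous_leftColon isHomogeneous_bot hx) hk hkI hkmin
  simp only [mem_leftColon_bot, hxL, ← hsu] at htu
  -- `R / (L : k s)` is isomorphic to both `R / L` and `R k t x`.
  have h1' : (1 : R) ∈ L ⊔ Submodule.span R {k * s} := by
    by_contra hn
    exact hksL (hmax _ (isHomogeneous_sup hL (isHomogeneous_span_left (mul_mem_degree hk hs))) hn
      le_sup_left (Submodule.mem_sup_right (Submodule.mem_span_singleton_self _)))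
  obtain ⟨l, hl, y, hy, hly⟩ := Submodule.mem_sup.1 h1'
  obtain ⟨r, rfl⟩ := mem_span_left.1 hy
  have hz0 : r * (k * t) * x ≠ 0 := fun h => h1 (by
    rw [← hly]
    exact L.add_mem hl ((htu r).1 h))
  have hLz : ∀ l' ∈ L, l' * (r * (k * t) * x) = 0 := fun l' hl' => by
    rw [← mul_assoc, ← mul_assoc, htu, mul_assoc, ← sub_eq_of_eq_add' hly.symm, mul_sub, mul_one]
    exact L.sub_mem hl' (left_mul_mem l' hl)
  have : ∃ g, component 𝒜 g (r * (k * t) * x) ≠ 0 := by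
    by_contra! hn
    exact hz0 (eq_zero_of_component 𝒜 hn)
  obtain ⟨g, hg⟩ := this
  refine ⟨g, _, component_mem 𝒜 g _, hg, fun l' hl' => ?_⟩
  have hle : L ≤ leftColon ⊥ (component 𝒜 g (r * (k * t) * x)) :=
    le_of_homogeneous_mem hL fun j l' hl'j hl' => by
      rw [mem_leftColon_bot, ← component_mul_of_left_mem hl'j, hLz l' hl', map_zero]
  exact mem_leftColon_bot.1 (hle hl')

theorem IsGradedLeftSelfInjective.leftDoubleAnnihilator (hinj : IsGradedLeftSelfInjective 𝒜)
    (hN : IsGradedRightNoetherian 𝒜) : LeftDoubleAnnihilator 𝒜 := by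
  intro U hU
  refine le_antisymm (le_of_homogeneous_mem
    (isHomogeneous_leftAnn (isHomogeneous_rightAnn hU)) fun i x hx hxU => ?_)
    (le_leftAnn_rightAnn U)
  by_contra hxn
  -- A simple quotient of `(U + R x) / U` embeds into `R`, and the embedding extends to a right
  -- multiplication which annihilates `U` but not `x`.
  obtain ⟨L, hUL, hL, h1L, hmax⟩ := exists_maximal_of_chain (𝒜 := 𝒜) (fun L => (1 : R) ∉ L)
    (isHomogeneous_leftColon hU hx) (by rwa [mem_leftColon, one_mul])
    (fun c hne hdir hc h => by
      obtain ⟨V, hV, h1V⟩ := (Submodule.mem_sSup_of_directed hne hdir).1 h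
      exact hc V hV h1V)
  obtain ⟨j, z, hz, hz0, hLz⟩ := hinj.exists_annihilated_by_maximal hN hL h1L hmax
  obtain ⟨c, hc, hxc⟩ := hinj.exists_mem_rightAnn_mul_eq hU hx hz fun r hr => hLz r (hUL hr)
  exact hz0 (hxc ▸ hxU c hc)

end Socle

/-! ### The opposite ring -/

section Opposite

open MulOpposite

variable {G : Type v} [AddGroup G] {R : Type u} [Ring R] (𝒜 : G → AddSubgroup R)

/-- The grading of the opposite ring; inverting the degrees makes it a grading by the same, not
necessarily commutative, group. -/
def opGrading (g : G) : AddSubgroup Rᵐᵒᵖ :=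
  (𝒜 (-g)).comap (opAddEquiv (α := R)).symm.toAddMonoidHom

variable {𝒜} in
theorem mem_opGrading {g : G} {x : Rᵐᵒᵖ} : x ∈ opGrading 𝒜 g ↔ x.unop ∈ 𝒜 (-g) := Iff.rfl

variable [DecidableEq G] [GradedRing 𝒜]

noncomputable instance opGrading.decomposition : Decomposition (opGrading 𝒜) :=
  decompositionOfProjections (opGrading 𝒜)
    (fun g => (opAddEquiv (α := R)).toAddMonoidHom.comp
      ((component 𝒜 (-g)).comp (opAddEquiv (α := R)).symm.toAddMonoidHom))
    (fun g x => component_mem 𝒜 (-g) x.unop)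
    (fun g x hx => unop_injective (component_of_mem 𝒜 hx))
    (fun g k x hx h => unop_injective (component_of_mem_ne 𝒜 hx (by simpa using h)))
    (fun x => by
      obtain ⟨s, hs⟩ := exists_sum_component 𝒜 x.unop
      refine ⟨s.map (Equiv.neg G).toEmbedding, unop_injective ?_⟩
      simpa [Finset.unop_sum] using hs)

noncomputable instance opGrading.gradedRing : GradedRing (opGrading 𝒜) where
  one_mem := by
    rw [mem_opGrading, neg_zero]
    exact SetLike.GradedOne.one_mem
  mul_mem i j x y hx hy := by
    rw [mem_opGrading, neg_add_rev]
    exact mul_mem_degree (mem_opGrading.1 hy) (mem_opGrading.1 hx)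

theorem component_opGrading (g : G) (x : Rᵐᵒᵖ) :
    component (opGrading 𝒜) g x = op (component 𝒜 (-g) x.unop) := by
  have key : component (opGrading 𝒜) g = (opAddEquiv (α := R)).toAddMonoidHom.comp
      ((component 𝒜 (-g)).comp (opAddEquiv (α := R)).symm.toAddMonoidHom) := by
    refine AddMonoidHom.ext fun x => ?_
    induction x using Decomposition.inductionOn (opGrading 𝒜) with
    | zero => simp
    | @homogeneous k m =>
      by_cases h : k = g
      · subst h
        rw [component_of_mem _ m.2]
        exact unop_injective (component_of_mem 𝒜 (mem_opGrading.1 m.2)).symm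
      · rw [component_of_mem_ne _ m.2 h]
        exact unop_injective
          (component_of_mem_ne 𝒜 (mem_opGrading.1 m.2) (by simpa using h)).symm
    | add x y hx hy => rw [map_add, map_add, hx, hy]
  exact DFunLike.congr_fun key x

/-- Graded right ideals of `R` are graded left ideals of the opposite ring. -/
noncomputable def gradedRightIdealEquiv :
    GradedRightIdeal 𝒜 ≃o GradedLeftIdeal (opGrading 𝒜) where
  toFun A := ⟨A.1.map (opLinearEquiv Rᵐᵒᵖ : R ≃ₗ[Rᵐᵒᵖ] Rᵐᵒᵖ).toLinearMap, by
    rintro g _ ⟨x, hx, rfl⟩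
    exact ⟨_, A.2 (-g) hx, (component_opGrading 𝒜 g (op x)).symm⟩⟩
  invFun U := ⟨U.1.comap (opLinearEquiv Rᵐᵒᵖ : R ≃ₗ[Rᵐᵒᵖ] Rᵐᵒᵖ).toLinearMap, by
    intro g x hx
    have h := U.2 (-g) hx
    change component (opGrading 𝒜) (-g) (op x) ∈ U.1 at h
    rw [component_opGrading, neg_neg] at h
    exact h⟩
  left_inv A := Subtype.ext (Submodule.comap_map_eq_of_injective
    (opLinearEquiv Rᵐᵒᵖ : R ≃ₗ[Rᵐᵒᵖ] Rᵐᵒᵖ).injective A.1)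
  right_inv U := Subtype.ext (Submodule.map_comap_eq_of_surjective
    (opLinearEquiv Rᵐᵒᵖ : R ≃ₗ[Rᵐᵒᵖ] Rᵐᵒᵖ).surjective U.1)
  map_rel_iff' := Submodule.map_le_map_iff_of_injective
    (opLinearEquiv Rᵐᵒᵖ : R ≃ₗ[Rᵐᵒᵖ] Rᵐᵒᵖ).injective _ _

variable {𝒜}

/-- The left-right dual of `IsGradedLeftSelfInjective.isGradedLeftArtinian`, with the double
annihilator condition in place of self-injectivity. -/
theorem LeftDoubleAnnihilator.isGradedRightArtinian (hl : LeftDoubleAnnihilator 𝒜)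
    (hN : IsGradedRightNoetherian 𝒜) : IsGradedRightArtinian 𝒜 := by
  have : WellFoundedGT (GradedRightIdeal 𝒜) := hN
  have hNop : IsGradedLeftNoetherian (opGrading 𝒜) :=
    (gradedRightIdealEquiv 𝒜).symm.strictMono.wellFoundedGT
  have hA : IsGradedLeftArtinian (opGrading 𝒜) := by
    refine hNop.isGradedLeftArtinian fun C ⟨x₀, hx₀⟩ hC => ?_
    have hhom : ∀ x ∈ C, (rightAnn (Submodule.span R {x.unop} : Set R)).IsHomogeneous 𝒜 :=
      fun x hx => by
        obtain ⟨g, hg⟩ := hC x hx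
        exact isHomogeneous_rightAnn (isHomogeneous_span_left (mem_opGrading.1 hg))
    obtain ⟨_, -, ⟨x, hx, rfl⟩, hmax⟩ := exists_maximal_homogeneous hN
      (fun A => ∃ x ∈ C, rightAnn (Submodule.span R {x.unop} : Set R) = A)
      ⟨_, hhom x₀ hx₀, x₀, hx₀, rfl⟩
    refine ⟨x, hx, fun r _ hxr => ?_⟩
    obtain ⟨g, hg⟩ := hC x hx
    obtain ⟨k, hk⟩ := hC _ hxr
    have hle : Submodule.span R {(x * r).unop} ≤ Submodule.span R {x.unop} :=
      (Submodule.span_singleton_le_iff_mem _ _).2 (mem_span_left.2 ⟨r.unop, rfl⟩)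
    have h1 := hmax _ (hhom _ hxr) ⟨_, hxr, rfl⟩ (rightAnn_anti hle)
    have h2 : x.unop ∈ Submodule.span R {(x * r).unop} := by
      rw [← hl _ (isHomogeneous_span_left (mem_opGrading.1 hk))]
      exact leftAnn_anti h1 (le_leftAnn_rightAnn _ (Submodule.mem_span_singleton_self _))
    obtain ⟨t, ht⟩ := mem_span_left.1 h2
    exact ⟨op t, unop_injective ht⟩
  have : WellFoundedLT (GradedLeftIdeal (opGrading 𝒜)) := hA
  exact (gradedRightIdealEquiv 𝒜).strictMono.wellFoundedLT

end Opposite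

end GradedQF

theorem theorem4p2 {G : Type v} [AddGroup G] [DecidableEq G] {R : Type u} [Ring R]
    (𝒜 : G → AddSubgroup R) [GradedRing 𝒜] :
    List.TFAE [
      GradedQF.IsGradedArtinian 𝒜 ∧
        GradedQF.RightDoubleAnnihilator 𝒜 ∧ GradedQF.LeftDoubleAnnihilator 𝒜,
      GradedQF.IsGradedLeftNoetherian 𝒜 ∧
        GradedQF.RightDoubleAnnihilator 𝒜 ∧ GradedQF.LeftDoubleAnnihilator 𝒜,
      GradedQF.IsGradedLeftNoetherian 𝒜 ∧ GradedQF.IsGradedLeftSelfInjective 𝒜,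
      GradedQF.IsGradedRightNoetherian 𝒜 ∧ GradedQF.IsGradedLeftSelfInjective 𝒜] := by
  tfae_have 1 → 2 := fun ⟨⟨_, hA⟩, hr, hl⟩ => ⟨hl.isGradedLeftNoetherian hA, hr, hl⟩
  tfae_have 2 → 3 := fun ⟨hN, hr, hl⟩ => ⟨hN, hN.isGradedLeftSelfInjective hr hl⟩
  tfae_have 3 → 4 := fun ⟨hN, hinj⟩ => by
    have hA := hinj.isGradedLeftArtinian hN
    exact ⟨(hinj.rightDoubleAnnihilator_of_isGradedLeftArtinian hA).isGradedRightNoetherian hA,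
      hinj⟩
  tfae_have 4 → 1 := fun ⟨hN, hinj⟩ => by
    have hl := hinj.leftDoubleAnnihilator hN
    exact ⟨⟨hl.isGradedLeftArtinian hN, hl.isGradedRightArtinian hN⟩,
      hinj.rightDoubleAnnihilator_of_isGradedRightNoetherian hN, hl⟩
  tfae_finish
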